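/- Proposition 2.2. For an integer $m\ge 1$ and $p\in(0,1]$, let $\mathcal T_m$ be a uniformly random tree with vertex set $\{1,\dots,m\}$, root it at $1$, and let $\vec{\mathcal T}_m$ be the digraph obtained by orienting all its edges toward the root $1$. Let $\vec G(m,p)$ be the random digraph on $\{1,\dots,m\}$ in which each of the $m(m-1)$ possible directed edges is present independently with probability $p$, taken independent of $\mathcal T_m$, and let $\vec{\mathcal T}_{m,p}$ be the digraph whose set of directed edges is the union of those of $\vec{\mathcal T}_m$ and $\vec G(m,p)$. A saop of length $k\ge 0$ in a digraph is a sequence of vertices $(v_0,v_1,\dots,v_k)$ such that the directed edges $(v_0,v_1),\dots,(v_{k-1},v_k)$ are pairwise different and all belong to the digraph. Let $L(\vec{\mathcal T}_{m,p})$ be the length of the longest saop in $\vec{\mathcal T}_{m,p}$. Then there exists a universal constant $C>0$ such that for every integer $m\ge 1$, every $p\in(0,1]$ and every real $x>0$, $$\mathbb P\bigl(L(\vec{\mathcal T}_{m,p})>x\sqrt m\bigr)\le C\left(\frac1{x^2}+p^{2/3}\,m\right).$$ -/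

import Mathlib

/-- A saop of length `k` in a digraph `G`: vertices `v₀, …, v_k` such that the oriented edges
`(v₀, v₁), …, (v_{k-1}, v_k)` all belong to `G` and are pairwise different. -/
def IsSaop {V : Type*} (G : Digraph V) {k : ℕ} (v : Fin (k + 1) → V) : Prop :=
  (∀ i : Fin k, G.Adj (v i.castSucc) (v i.succ)) ∧
    Function.Injective fun i : Fin k => (v i.castSucc, v i.succ)

/-- The set of lengths of the saops of `G`. -/
def saopLengths {V : Type*} (G : Digraph V) : Set ℕ :=
  {k | ∃ v : Fin (k + 1) → V, IsSaop G v}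

/-- The length of the longest saop of `G`. -/
noncomputable def longestSaop {V : Type*} (G : Digraph V) : ℕ :=
  sSup (saopLengths G)

/-- The supremum in `longestSaop` is over a bounded set when there are finitely many vertices. -/
theorem bddAbove_saopLengths {V : Type*} [Finite V] (G : Digraph V) :
    BddAbove (saopLengths G) := by
  refine ⟨Nat.card (V × V), ?_⟩
  rintro k ⟨v, -, hv⟩
  simpa using Nat.card_le_card_of_injective _ hv

/-- The supremum in `longestSaop` is over a non-empty set when there is a vertex. -/
theorem saopLengths_nonempty {V : Type*} [Nonempty V] (G : Digraph V) :
    (saopLengths G).Nonempty :=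
  ⟨0, fun _ => Classical.arbitrary V, fun i => i.elim0, fun i => i.elim0⟩

/-- The edges of the tree `T`, oriented toward the root `r`: the edge `{u, v}` is oriented from
its end `u` farther from `r` to its end `v` closer to `r`. -/
def orientToRoot {V : Type*} (T : SimpleGraph V) (r : V) : Digraph V where
  Adj u v := T.Adj u v ∧ T.dist v r < T.dist u r

/-- The digraph with a given set of oriented edges. -/
def digraphOfEdges {V : Type*} (E : Set (V × V)) : Digraph V where
  Adj u v := (u, v) ∈ E

/-- The law of a uniform tree with vertex set `Fin m`. -/
noncomputable def uniformTreeLaw (m : ℕ) : MeasureTheory.Measure (SimpleGraph (Fin m)) :=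
  ProbabilityTheory.uniformOn {T | T.IsTree}

/-- The law of the set of oriented edges of the random digraph on `Fin m` in which each of the
`m (m - 1)` possible oriented edges is present with probability `p`, independently. -/
noncomputable def randomDigraphLaw (m : ℕ) (p : unitInterval) :
    MeasureTheory.Measure (Set (Fin m × Fin m)) :=
  ProbabilityTheory.setBernoulli {e | e.1 ≠ e.2} p

/-- The joint law of a uniform tree and of the set of edges of an independent random digraph. -/
noncomputable def treeAndDigraphLaw (m : ℕ) (p : unitInterval) :
    MeasureTheory.Measure (SimpleGraph (Fin m) × Set (Fin m × Fin m)) :=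
  (uniformTreeLaw m).prod (randomDigraphLaw m p)

/-- The union of the tree, rooted at the first vertex and oriented toward it, and of the
digraph. -/
def treeUnionDigraph {m : ℕ} [NeZero m] (ω : SimpleGraph (Fin m) × Set (Fin m × Fin m)) :
    Digraph (Fin m) :=
  orientToRoot ω.1 0 ⊔ digraphOfEdges ω.2

instance instMeasurableSingletonClassSimpleGraphFin (m : ℕ) :
    MeasurableSingletonClass (SimpleGraph (Fin m)) := by
  refine ⟨fun T => ?_⟩
  have h : ({T} : Set (SimpleGraph (Fin m))) = SimpleGraph.edgeSet ⁻¹' {T.edgeSet} := by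
    ext T'
    simp
  rw [h]
  exact SimpleGraph.measurable_edgeSet (MeasurableSet.singleton _)

theorem isProbabilityMeasure_uniformTreeLaw (m : ℕ) [NeZero m] :
    MeasureTheory.IsProbabilityMeasure (uniformTreeLaw m) := by
  obtain ⟨T, -, hT⟩ := (SimpleGraph.connected_top (V := Fin m)).exists_isTree_le
  exact ProbabilityTheory.isProbabilityMeasure_uniformOn (Set.toFinite _) ⟨T, hT⟩

theorem isProbabilityMeasure_treeAndDigraphLaw (m : ℕ) [NeZero m] (p : unitInterval) :
    MeasureTheory.IsProbabilityMeasure (treeAndDigraphLaw m p) := by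
  have := isProbabilityMeasure_uniformTreeLaw m
  unfold treeAndDigraphLaw randomDigraphLaw
  infer_instance

/-- Every event is measurable, in particular those about `longestSaop`. -/
theorem measurableSet_event (m : ℕ) (A : Set (SimpleGraph (Fin m) × Set (Fin m × Fin m))) :
    MeasurableSet A :=
  A.toFinite.measurableSet

/-! Rooted trees are encoded by their parent maps. Given the tree, the random edges enter only
through union bounds, whose costs are fourth powers of heights of subtrees; so the proof needs
fourth moments of heights and a deterministic bound on saops.

Heights. Cutting the edge above a vertex (`sum_forestMaps_detach`), with the exchangeability of the
roots, compares numbers of forests (`card_forestMaps_ratio`). This gives at most `k + 1` vertices at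
depth `k` on average (`sum_levelCard_le`), hence depths at least of order `√n` on average
(`le_sum_hitTime`). Let `s` run over the sizes of the subtrees of the children of the root. By
induction the fourth power of the height costs about `C ∑ s² = C (n ∑ s - ∑ s (n - s))`, and the
mean of `∑ s (n - s)` is that of the sum of the depths (`sum_children_eq`), so at least of order
`n^(3/2)`. This gain pays for the extra level, and the fourth moment is `O(n²)`
(`sum_height_pow_le`). Summed over all subtrees, fourth powers have mean `O(n^(5/2))`
(`sum_sum_height_pow_le`).

Saops. A saop consists of tree segments joined by distinct random edges, and the segment before a
random edge is at most as long as the height of the subtree at its origin (`exists_chain_of_walk`).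
Unless five successive random edges are separated by short segments (`HasShortJumps`), these heights
grow geometrically along the saop, so the length is at most the height of the tree plus 16 times the
largest one (`longestSaop_le`).

Probabilities. By union bounds, a random edge starts at a subtree of height of order `√m` with
probability `O(p m^(3/2))`, and five short jumps exist with probability `O(p^5 m^(15/2))`. These are
powers 3/2 and 15/2 of `p^(2/3) m`, so both are `O(p^(2/3) m)` when that quantity is at most 1. -/

/-! ### Parent maps, reachability and hitting times -/

/-- Some iterate of `f` maps `x` to `v`. -/
def Reaches {α : Type*} (f : α → α) (x v : α) : Prop := ∃ k, f^[k] x = v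

/-- The number of iterations of `f` needed to go from `x` to `v`. -/
noncomputable def hitTime {α : Type*} (f : α → α) (x v : α) : ℕ := sInf {k | f^[k] x = v}

/-- `f` is the parent map of a forest with set of roots `R` and set of other vertices `W`; it fixes
the roots and the points outside of the forest. -/
def IsForestMap {α : Type*} (W R : Finset α) (f : α → α) : Prop :=
  (∀ x, x ∉ W → f x = x) ∧ ∀ x ∈ W, ∃ v ∈ R, Reaches f x v

section Reaches

variable {α : Type*} {f : α → α} {x y v : α}

theorem Reaches.refl (f : α → α) (x : α) : Reaches f x x := ⟨0, rfl⟩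

theorem Reaches.trans {z : α} (h : Reaches f x y) (h' : Reaches f y z) : Reaches f x z := by
  obtain ⟨k, rfl⟩ := h
  obtain ⟨l, rfl⟩ := h'
  exact ⟨l + k, Function.iterate_add_apply f l k x⟩

theorem Reaches.step (f : α → α) (x : α) : Reaches f x (f x) := ⟨1, rfl⟩

theorem Reaches.head (h : Reaches f (f x) v) : Reaches f x v := (Reaches.step f x).trans h

theorem Reaches.of_ne (h : Reaches f x v) (hne : x ≠ v) : Reaches f (f x) v := by
  obtain ⟨k, hk⟩ := h
  cases k with
  | zero => exact absurd hk hne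
  | succ k => exact ⟨k, hk⟩

theorem Reaches.induction {P : α → Prop} (h : Reaches f x v) (base : P v)
    (step : ∀ z, z ≠ v → Reaches f (f z) v → P (f z) → P z) : P x := by
  obtain ⟨k, hk⟩ := h
  induction k generalizing x with
  | zero => exact (show x = v from hk) ▸ base
  | succ k ih =>
    by_cases hx : x = v
    · exact hx ▸ base
    · exact step x hx ⟨k, hk⟩ (ih hk)

theorem Reaches.eq_of_fixed (h : Reaches f x v) (hx : f x = x) : x = v := by
  obtain ⟨k, rfl⟩ := h
  exact (Function.iterate_fixed hx k).symm

@[simp] theorem hitTime_self (f : α → α) (x : α) : hitTime f x x = 0 :=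
  Nat.sInf_eq_zero.2 (Or.inl rfl)

theorem iterate_hitTime (h : Reaches f x v) : f^[hitTime f x v] x = v := Nat.sInf_mem h

theorem hitTime_le {k : ℕ} (h : f^[k] x = v) : hitTime f x v ≤ k := Nat.sInf_le h

theorem hitTime_of_ne (h : Reaches f (f x) v) (hne : x ≠ v) :
    hitTime f x v = hitTime f (f x) v + 1 := by
  apply le_antisymm
  · exact hitTime_le (iterate_hitTime h)
  · have h1 := iterate_hitTime h.head
    cases hk : hitTime f x v with
    | zero => rw [hk] at h1; exact absurd h1 hne
    | succ k =>
      rw [hk] at h1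
      exact Nat.succ_le_succ (hitTime_le h1)

theorem hitTime_le_add (h : Reaches f y v) {k : ℕ} (hk : f^[k] x = y) :
    hitTime f x v ≤ hitTime f y v + k := by
  apply hitTime_le
  rw [Function.iterate_add_apply, hk, iterate_hitTime h]

theorem Reaches.conj {x y : α} (σ : Equiv.Perm α) (h : Reaches f x y) :
    Reaches (fun z => σ (f (σ⁻¹ z))) (σ x) (σ y) := by
  obtain ⟨k, rfl⟩ := h
  refine ⟨k, ?_⟩
  have hs : Function.Semiconj σ f (fun z => σ (f (σ⁻¹ z))) := fun z => by simp
  exact ((hs.iterate_right k).eq x).symm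

variable [DecidableEq α]

/-- Before its first visit to `u`, an orbit does not use the value of the map at `u`. Hence the
subtree of `u` and all its statistics ignore the parent of `u`. -/
theorem Reaches.update {u : α} (h : Reaches f x u) (y : α) :
    Reaches (Function.update f u y) x u := by
  refine h.induction (P := fun z => Reaches (Function.update f u y) z u) (.refl _ _) ?_
  intro z hz _ ih
  apply Reaches.head
  rwa [Function.update_of_ne hz]

theorem update_update_self (f : α → α) (u y : α) :
    Function.update (Function.update f u y) u (f u) = f := by
  simp

theorem reaches_update_iff {u y : α} :
    Reaches (Function.update f u y) x u ↔ Reaches f x u := by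
  refine ⟨fun h => ?_, fun h => h.update y⟩
  have := h.update (f u)
  rwa [update_update_self] at this

theorem hitTime_update {u : α} (h : Reaches f x u) (y : α) :
    hitTime (Function.update f u y) x u = hitTime f x u := by
  refine h.induction (P := fun z => hitTime (Function.update f u y) z u = hitTime f z u)
    (by simp) ?_
  intro z hz hr ih
  rw [hitTime_of_ne hr hz, ← ih, hitTime_of_ne _ hz, Function.update_of_ne hz]
  rw [Function.update_of_ne hz]
  exact hr.update y

theorem iterate_update_of_not_reaches {u : α} (h : ¬ Reaches f x u) (y : α) (k : ℕ) :
    (Function.update f u y)^[k] x = f^[k] x := by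
  induction k with
  | zero => rfl
  | succ k ih =>
    rw [Function.iterate_succ_apply', Function.iterate_succ_apply', ih, Function.update_of_ne]
    exact fun hk => h ⟨k, hk⟩

end Reaches

/-! ### Cutting and grafting in forests -/

section IsForestMap

variable {α : Type*} {W R : Finset α} {f : α → α}

theorem IsForestMap.induction (hf : IsForestMap W R f) {P : α → Prop} (root : ∀ x ∈ R, P x)
    (step : ∀ x ∈ W, P (f x) → P x) {x : α} (hx : x ∈ W ∨ x ∈ R) : P x := by
  have key : ∀ k x, x ∈ W → f^[k] x ∈ R → P x := by
    intro k
    induction k with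
    | zero => exact fun x _ hxR => root x hxR
    | succ k ih =>
      intro x hxW hxk
      by_cases hfx : f x ∈ W
      · exact step x hxW (ih _ hfx hxk)
      · refine step x hxW (root _ ?_)
        have : f^[k] (f x) = f x := Function.iterate_fixed (hf.1 _ hfx) k
        rw [Function.iterate_succ_apply, this] at hxk
        exact hxk
  rcases hx with hx | hx
  · obtain ⟨v, hv, k, rfl⟩ := hf.2 x hx
    exact key k x hx hv
  · exact root x hx

theorem IsForestMap.apply_mem (hf : IsForestMap W R f) (hd : Disjoint W R) {x : α} (hx : x ∈ W) :
    f x ∈ W ∨ f x ∈ R := by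
  by_cases hfx : f x ∈ W
  · exact Or.inl hfx
  · obtain ⟨v, hv, hr⟩ := hf.2 x hx
    have hne : x ≠ v := fun h => Finset.disjoint_left.1 hd hx (h ▸ hv)
    rw [(hr.of_ne hne).eq_of_fixed (hf.1 _ hfx)]
    exact Or.inr hv

theorem IsForestMap.fixed (hf : IsForestMap W R f) (hd : Disjoint W R) {x : α} (hx : x ∈ R) :
    f x = x := hf.1 x (Finset.disjoint_right.1 hd hx)

/-- A vertex on a cycle returns to itself forever, whereas an orbit that reaches a root stays there.
-/
theorem IsForestMap.not_reaches (hf : IsForestMap W R f) (hd : Disjoint W R) {x : α}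
    (hx : x ∈ W) : ¬ Reaches f (f x) x := by
  rintro ⟨k, hk⟩
  obtain ⟨v, hv, j, hj⟩ := hf.2 x hx
  have hper : f^[j * (k + 1)] x = x :=
    (Function.IsPeriodicPt.const_mul (show Function.IsPeriodicPt f (k + 1) x from hk) j)
  have hle : j ≤ j * (k + 1) := Nat.le_mul_of_pos_right j k.succ_pos
  rw [← Nat.sub_add_cancel hle, Function.iterate_add_apply, hj,
    Function.iterate_fixed (hf.fixed hd hv)] at hper
  exact Finset.disjoint_left.1 hd hx (hper ▸ hv)

theorem IsForestMap.mem_of_reaches (hf : IsForestMap W R f) {x v : α}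
    (hv : v ∈ W ∨ v ∈ R) (h : Reaches f x v) : x ∈ W ∨ x ∈ R := by
  by_cases hx : x ∈ W
  · exact Or.inl hx
  · exact (h.eq_of_fixed (hf.1 x hx)) ▸ hv

theorem IsForestMap.root_unique (hf : IsForestMap W R f) (hd : Disjoint W R) {x u v : α}
    (hu : u ∈ R) (hv : v ∈ R) (hxu : Reaches f x u) (hxv : Reaches f x v) : u = v := by
  obtain ⟨k, hk⟩ := hxu
  obtain ⟨l, hl⟩ := hxv
  have h1 : f^[k + l] x = u := by
    rw [add_comm, Function.iterate_add_apply, hk, Function.iterate_fixed (hf.fixed hd hu)]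
  have h2 : f^[k + l] x = v := by
    rw [Function.iterate_add_apply, hl, Function.iterate_fixed (hf.fixed hd hv)]
  exact h1.symm.trans h2

theorem IsForestMap.conj (hf : IsForestMap W R f) (σ : Equiv.Perm α) (hW : ∀ x ∈ W, σ x = x)
    (hR : ∀ x, σ x ∈ R ↔ x ∈ R) : IsForestMap W R (fun z => σ (f (σ⁻¹ z))) := by
  refine ⟨fun x hx => ?_, fun x hx => ?_⟩
  · have hx' : σ (σ⁻¹ x) = x := by simp
    have : σ⁻¹ x ∉ W := fun h => by
      have h' := hW _ h
      rw [hx'] at h'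
      exact hx (by rwa [← h'] at h)
    show σ (f (σ⁻¹ x)) = x
    rw [hf.1 _ this, hx']
  · obtain ⟨v, hv, hr⟩ := hf.2 x hx
    refine ⟨σ v, (hR v).2 hv, ?_⟩
    have := hr.conj σ
    rwa [hW x hx] at this

variable [DecidableEq α]

theorem disjoint_erase_insert (hd : Disjoint W R) (u : α) :
    Disjoint (W.erase u) (insert u R) := by
  rw [Finset.disjoint_left] at *
  intro x hx hx'
  rcases Finset.mem_insert.1 hx' with rfl | h
  · exact Finset.notMem_erase _ _ hx
  · exact hd (Finset.mem_of_mem_erase hx) h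

theorem erase_union_insert {u : α} (hu : u ∈ W) : W.erase u ∪ insert u R = W ∪ R := by
  ext x
  by_cases hx : x = u <;> simp [hx, hu]

theorem IsForestMap.detach (hf : IsForestMap W R f) (u : α) :
    IsForestMap (W.erase u) (insert u R) (Function.update f u u) := by
  refine ⟨fun x hx => ?_, fun x hx => ?_⟩
  · by_cases hxu : x = u
    · simp [hxu]
    · rw [Function.update_of_ne hxu]
      exact hf.1 x fun h => hx (Finset.mem_erase.2 ⟨hxu, h⟩)
  · refine hf.induction
      (P := fun z => ∃ v ∈ insert u R, Reaches (Function.update f u u) z v) ?_ ?_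
      (Or.inl (Finset.mem_of_mem_erase hx))
    · exact fun z hz => ⟨z, Finset.mem_insert_of_mem hz, .refl _ _⟩
    · rintro z - ⟨v, hv, hr⟩
      by_cases hzu : z = u
      · exact ⟨u, Finset.mem_insert_self _ _, hzu ▸ .refl _ _⟩
      · refine ⟨v, hv, Reaches.head ?_⟩
        rwa [Function.update_of_ne hzu]

/-- Inverse of `IsForestMap.detach`. Requiring the new parent to lie outside the tree of `u` is
exactly what prevents a cycle. -/
theorem IsForestMap.attach {u y : α} (hf : IsForestMap (W.erase u) (insert u R) f)
    (hu : u ∈ W) (hy : y ∈ W ∨ y ∈ R) (hyu : ¬ Reaches f y u) :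
    IsForestMap W R (Function.update f u y) := by
  have hy' : ∃ v ∈ R, Reaches (Function.update f u y) y v := by
    have : ∃ v ∈ insert u R, Reaches f y v := by
      rcases hy with hy | hy
      · refine hf.2 y (Finset.mem_erase.2 ⟨?_, hy⟩)
        rintro rfl
        exact hyu (.refl _ _)
      · exact ⟨y, Finset.mem_insert_of_mem hy, .refl _ _⟩
    obtain ⟨v, hv, k, hk⟩ := this
    refine ⟨v, Finset.mem_of_mem_insert_of_ne hv fun h => hyu ⟨k, hk.trans h⟩, k, ?_⟩
    rw [iterate_update_of_not_reaches hyu, hk]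
  refine ⟨fun x hx => ?_, fun x hx => ?_⟩
  · rw [Function.update_of_ne (by rintro rfl; exact hx hu)]
    exact hf.1 x fun h => hx (Finset.mem_of_mem_erase h)
  · have huP : ∃ v ∈ R, Reaches (Function.update f u y) u v := by
      obtain ⟨v, hv, hr⟩ := hy'
      refine ⟨v, hv, Reaches.head ?_⟩
      rwa [Function.update_self]
    by_cases hxu : x = u
    · rwa [hxu]
    refine hf.induction (P := fun z => ∃ v ∈ R, Reaches (Function.update f u y) z v) ?_ ?_
      (Or.inl (Finset.mem_erase.2 ⟨hxu, hx⟩))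
    · intro z hz
      rcases Finset.mem_insert.1 hz with rfl | hz
      · exact huP
      · exact ⟨z, hz, .refl _ _⟩
    · rintro z hz ⟨v, hv, hr⟩
      refine ⟨v, hv, Reaches.head ?_⟩
      rwa [Function.update_of_ne (Finset.ne_of_mem_erase hz)]

end IsForestMap

/-! ### Counting forests by cutting an edge -/

open Classical in
/-- The points that some iterate of `f` maps to `v`. -/
noncomputable def descendants {α : Type*} [Fintype α] (f : α → α) (v : α) : Finset α :=
  {x | Reaches f x v}

open Classical in
/-- The parent maps of the forests with set of roots `R` and set of other vertices `W`. -/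
noncomputable def forestMaps {α : Type*} [Fintype α] [DecidableEq α] (W R : Finset α) :
    Finset (α → α) :=
  {f | IsForestMap W R f}

/-- The greatest number of iterations of `f` needed to reach `v`. -/
noncomputable def height {α : Type*} [Fintype α] (f : α → α) (v : α) : ℕ :=
  (descendants f v).sup fun x => hitTime f x v

/-- The number of points that reach `v` in `k` iterations and not earlier. -/
noncomputable def levelCard {α : Type*} [Fintype α] (f : α → α) (v : α) (k : ℕ) : ℕ :=
  ((descendants f v).filter fun x => hitTime f x v = k).card

section Forests

variable {α : Type*} [Fintype α] {f : α → α} {x v : α}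

@[simp] theorem mem_descendants : x ∈ descendants f v ↔ Reaches f x v := by
  simp [descendants]

theorem self_mem_descendants (f : α → α) (v : α) : v ∈ descendants f v :=
  mem_descendants.2 (.refl _ _)

theorem hitTime_le_height (h : Reaches f x v) : hitTime f x v ≤ height f v :=
  Finset.le_sup (f := fun x => hitTime f x v) (mem_descendants.2 h)

variable [DecidableEq α] {W R : Finset α}

@[simp] theorem mem_forestMaps : f ∈ forestMaps W R ↔ IsForestMap W R f := by
  simp [forestMaps]

theorem descendants_update (f : α → α) (u y : α) :
    descendants (Function.update f u y) u = descendants f u := by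
  ext x
  simp [reaches_update_iff]

theorem height_update (f : α → α) (u y : α) :
    height (Function.update f u y) u = height f u := by
  unfold height
  rw [descendants_update]
  exact Finset.sup_congr rfl fun x hx => hitTime_update (mem_descendants.1 hx) y

theorem levelCard_update (f : α → α) (u y : α) (k : ℕ) :
    levelCard (Function.update f u y) u k = levelCard f u k := by
  unfold levelCard
  rw [descendants_update]
  congr 1
  exact Finset.filter_congr fun x hx => by rw [hitTime_update (mem_descendants.1 hx) y]

/-- Cutting the edge above `u`: the parent of `u` is any vertex outside of the tree of `u`. -/
theorem sum_forestMaps_detach (hd : Disjoint W R) {u : α} (hu : u ∈ W)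
    (φ : (α → α) → α → ℝ) :
    ∑ f ∈ forestMaps W R, φ (Function.update f u u) (f u) =
      ∑ f ∈ forestMaps (W.erase u) (insert u R), ∑ x ∈ (W ∪ R) \ descendants f u, φ f x := by
  rw [Finset.sum_sigma']
  refine Finset.sum_bij' (fun f _ => ⟨Function.update f u u, f u⟩)
    (fun s _ => Function.update s.1 u s.2) ?_ ?_ ?_ ?_ ?_
  · intro f hf
    rw [mem_forestMaps] at hf
    simp only [Finset.mem_sigma, mem_forestMaps, Finset.mem_sdiff, Finset.mem_union,
      mem_descendants, reaches_update_iff]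
    exact ⟨hf.detach u, hf.apply_mem hd hu, hf.not_reaches hd hu⟩
  · rintro ⟨f, x⟩ hs
    simp only [Finset.mem_sigma, mem_forestMaps, Finset.mem_sdiff, Finset.mem_union,
      mem_descendants] at hs
    exact mem_forestMaps.2 (hs.1.attach hu hs.2.1 hs.2.2)
  · intro f _
    simp
  · rintro ⟨f, x⟩ hs
    simp only [Finset.mem_sigma, mem_forestMaps] at hs
    have hfu : f u = u := hs.1.1 u (Finset.notMem_erase u W)
    simp only [Function.update_self, Function.update_idem]
    rw [← hfu]
    simp [hfu]
  · intro f _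
    rfl

theorem IsForestMap.descendants_subset (hf : IsForestMap W R f) (hv : v ∈ W ∨ v ∈ R) :
    descendants f v ⊆ W ∪ R := fun _ hx =>
  Finset.mem_union.2 (hf.mem_of_reaches hv (mem_descendants.1 hx))

/-- The trees of a forest form a partition of its vertices. -/
theorem IsForestMap.sum_card_descendants (hf : IsForestMap W R f) (hd : Disjoint W R) :
    ∑ v ∈ R, (descendants f v).card = (W ∪ R).card := by
  rw [← Finset.card_biUnion]
  · congr 1
    ext x
    simp only [Finset.mem_biUnion, mem_descendants, Finset.mem_union]
    constructor
    · rintro ⟨v, hv, hr⟩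
      exact hf.mem_of_reaches (Or.inr hv) hr
    · rintro (hx | hx)
      · exact hf.2 x hx
      · exact ⟨x, hx, .refl _ _⟩
  · intro u hu v hv huv
    rw [Function.onFun, Finset.disjoint_left]
    intro x hxu hxv
    exact huv (hf.root_unique hd hu hv (mem_descendants.1 hxu) (mem_descendants.1 hxv))

/-- All the trees of a random forest have the same mean size. -/
theorem sum_card_descendants_le (hd : Disjoint W R) {x y : α} (hx : x ∈ R) (hy : y ∈ R) :
    ∑ f ∈ forestMaps W R, ((descendants f x).card : ℝ) ≤
      ∑ f ∈ forestMaps W R, ((descendants f y).card : ℝ) := by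
  -- Relabelling by the transposition of the two roots permutes the forests and exchanges the two
  -- trees.
  set σ : Equiv.Perm α := Equiv.swap x y with hσ
  have hσσ : ∀ z, σ (σ z) = z := fun z => by simp [hσ]
  have hinv : σ⁻¹ = σ := by simp [hσ]
  have hW : ∀ z ∈ W, σ z = z := fun z hz =>
    Equiv.swap_apply_of_ne_of_ne (fun h => Finset.disjoint_left.1 hd hz (h ▸ hx))
      fun h => Finset.disjoint_left.1 hd hz (h ▸ hy)
  have hR' : ∀ z ∈ R, σ z ∈ R := fun z hz => by
    rw [hσ, Equiv.swap_apply_def]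
    split_ifs
    exacts [hy, hx, hz]
  have hR : ∀ z, σ z ∈ R ↔ z ∈ R := fun z => ⟨fun h => hσσ z ▸ hR' _ h, hR' z⟩
  calc ∑ f ∈ forestMaps W R, ((descendants f x).card : ℝ)
      ≤ ∑ f ∈ forestMaps W R, ((descendants (fun z => σ (f (σ z))) y).card : ℝ) := by
        refine Finset.sum_le_sum fun f _ => ?_
        have hsub : (descendants f x).image σ ⊆ descendants (fun z => σ (f (σ z))) y := by
          intro z hz
          obtain ⟨w, hw, rfl⟩ := Finset.mem_image.1 hz
          have := (mem_descendants.1 hw).conj σ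
          rw [hinv] at this
          rw [mem_descendants]
          simpa [hσ] using this
        have := Finset.card_le_card hsub
        rw [Finset.card_image_of_injective _ σ.injective] at this
        exact_mod_cast this
    _ = ∑ f ∈ forestMaps W R, ((descendants f y).card : ℝ) := by
        have hmem : ∀ f ∈ forestMaps W R, (fun z => σ (f (σ z))) ∈ forestMaps W R := by
          intro f hf
          rw [mem_forestMaps] at hf ⊢
          have := hf.conj σ hW hR
          rwa [hinv] at this
        refine Finset.sum_bij' (fun f _ z => σ (f (σ z))) (fun f _ z => σ (f (σ z))) hmem hmem
          ?_ ?_ ?_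
        · intro f _; funext z; simp [hσσ]
        · intro f _; funext z; simp [hσσ]
        · intro f _; rfl

/-- The sizes of the trees add up to the number of vertices, and each root has an equal share on
average. -/
theorem card_mul_sum_card_descendants (hd : Disjoint W R) (hv : v ∈ R) :
    (R.card : ℝ) * ∑ f ∈ forestMaps W R, ((descendants f v).card : ℝ) =
      ((W ∪ R).card : ℝ) * (forestMaps W R).card := by
  have h1 : ∑ x ∈ R, ∑ f ∈ forestMaps W R, ((descendants f x).card : ℝ) =
      (R.card : ℝ) * ∑ f ∈ forestMaps W R, ((descendants f v).card : ℝ) := by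
    rw [← nsmul_eq_mul, ← Finset.sum_const]
    exact Finset.sum_congr rfl fun x hx =>
      le_antisymm (sum_card_descendants_le hd hx hv) (sum_card_descendants_le hd hv hx)
  rw [← h1, Finset.sum_comm, mul_comm, ← nsmul_eq_mul, ← Finset.sum_const]
  refine Finset.sum_congr rfl fun f hf => ?_
  exact_mod_cast (mem_forestMaps.1 hf).sum_card_descendants hd

theorem card_sdiff_descendants {u : α} (hu : u ∈ W)
    (hf : IsForestMap (W.erase u) (insert u R) f) :
    (((W ∪ R) \ descendants f u).card : ℝ) = (W ∪ R).card - (descendants f u).card := by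
  have := hf.descendants_subset (Or.inr (Finset.mem_insert_self u R))
  rw [erase_union_insert hu] at this
  rw [Finset.card_sdiff_of_subset this, Nat.cast_sub (Finset.card_le_card this)]

/-- Once `u` is a root, its possible parents are the vertices outside its tree. -/
theorem card_forestMaps_detach (hd : Disjoint W R) {u : α} (hu : u ∈ W) :
    ((forestMaps W R).card : ℝ) =
      ∑ f ∈ forestMaps (W.erase u) (insert u R),
        (((W ∪ R).card : ℝ) - (descendants f u).card) := by
  have h := sum_forestMaps_detach hd hu fun _ _ => 1
  simp only [Finset.sum_const, nsmul_eq_mul, mul_one] at h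
  rw [h]
  exact Finset.sum_congr rfl fun f hf => card_sdiff_descendants hu (mem_forestMaps.1 hf)

/-- The ratio between the numbers of forests with consecutive numbers of roots. -/
theorem card_forestMaps_ratio (hd : Disjoint W R) {u : α} (hu : u ∈ W) :
    ((R.card : ℝ) + 1) * (forestMaps W R).card =
      R.card * (W ∪ R).card * (forestMaps (W.erase u) (insert u R)).card := by
  have huR : u ∉ R := Finset.disjoint_left.1 hd hu
  have h := card_mul_sum_card_descendants (disjoint_erase_insert hd u)
    (Finset.mem_insert_self u R)
  rw [erase_union_insert hu, Finset.card_insert_of_notMem huR] at h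
  rw [card_forestMaps_detach hd hu, Finset.sum_sub_distrib, Finset.sum_const, nsmul_eq_mul]
  push_cast at h
  linear_combination -h

end Forests

/-! ### Mean level sizes and mean depth -/

section Levels

variable {α : Type*} {W R : Finset α} {f : α → α}

/-- The first vertex on the way to `v` whose image is `v`. -/
theorem Reaches.exists_last {x v : α} (h : Reaches f x v) (hne : x ≠ v) :
    ∃ u, u ≠ v ∧ f u = v ∧ Reaches f x u ∧ hitTime f x v = hitTime f x u + 1 := by
  refine (h.induction (P := fun x => x ≠ v → ∃ u, u ≠ v ∧ f u = v ∧ Reaches f x u ∧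
    hitTime f x v = hitTime f x u + 1) (fun h => absurd rfl h) ?_) hne
  intro z hz hr ih _
  by_cases hfz : f z = v
  · refine ⟨z, hz, hfz, .refl _ _, ?_⟩
    rw [hitTime_of_ne hr hz, hfz, hitTime_self, hitTime_self]
  · obtain ⟨u, huv, hfu, hzu, hu⟩ := ih hfz
    refine ⟨u, huv, hfu, hzu.head, ?_⟩
    by_cases hzu' : z = u
    · exact absurd (hzu' ▸ hfu) hfz
    · rw [hitTime_of_ne hr hz, hitTime_of_ne hzu hzu', hu]

variable [Fintype α]

theorem levelCard_zero (f : α → α) (v : α) : levelCard f v 0 = 1 := by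
  rw [levelCard, Finset.card_eq_one]
  refine ⟨v, ?_⟩
  ext x
  simp only [Finset.mem_filter, mem_descendants, Finset.mem_singleton]
  constructor
  · rintro ⟨hr, h0⟩
    have := iterate_hitTime hr
    rwa [h0] at this
  · rintro rfl
    exact ⟨.refl _ _, hitTime_self _ _⟩

variable [DecidableEq α]

/-- The path from a vertex at level `k + 1` enters `v` through a child `u`, and the vertex is at
level `k` for `u`. -/
theorem levelCard_succ_le (hf : IsForestMap W R f) {v : α} (k : ℕ) :
    levelCard f v (k + 1) ≤ ∑ u ∈ W, if f u = v then levelCard f u k else 0 := by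
  rw [← Finset.sum_filter]
  refine (Finset.card_le_card ?_).trans Finset.card_biUnion_le
  intro x hx
  simp only [Finset.mem_filter, mem_descendants, Finset.mem_biUnion] at hx ⊢
  have hne : x ≠ v := by
    rintro rfl
    simp at hx
  obtain ⟨u, huv, hfu, hxu, hk⟩ := hx.1.exists_last hne
  refine ⟨u, ⟨?_, hfu⟩, hxu, by omega⟩
  by_contra hu
  exact huv ((hf.1 u hu).symm.trans hfu)

/-- Grafting `u` on the root `v` is always allowed, because another root is never in the tree of
`u`; so the forests in which `u` is a child of `v` correspond to all forests with `u` as an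
additional root. -/
theorem sum_forestMaps_root (hd : Disjoint W R) {u v : α} (hu : u ∈ W) (hv : v ∈ R)
    (φ : (α → α) → ℝ) :
    ∑ f ∈ forestMaps W R, (if f u = v then φ (Function.update f u u) else 0) =
      ∑ f ∈ forestMaps (W.erase u) (insert u R), φ f := by
  rw [sum_forestMaps_detach hd hu fun f x => if x = v then φ f else 0]
  refine Finset.sum_congr rfl fun f hf => ?_
  rw [mem_forestMaps] at hf
  rw [Finset.sum_ite_eq', if_pos]
  rw [Finset.mem_sdiff, Finset.mem_union, mem_descendants]
  refine ⟨Or.inr hv, fun h => ?_⟩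
  have hvu := h.eq_of_fixed
    (hf.fixed (disjoint_erase_insert hd u) (Finset.mem_insert_of_mem hv))
  exact Finset.disjoint_left.1 hd hu (hvu ▸ hv)

/-- The mean number of vertices at distance `k` of a given root of a random forest. -/
theorem sum_levelCard_le (k : ℕ) : ∀ (W R : Finset α), Disjoint W R → ∀ v ∈ R,
    (R.card : ℝ) * ∑ f ∈ forestMaps W R, (levelCard f v k : ℝ) ≤
      (R.card + k) * (forestMaps W R).card := by
  induction k with
  | zero =>
    intro W R _ v _
    simp [levelCard_zero]
  | succ k ih =>
    intro W R hd v hv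
    have hr : (0 : ℝ) < R.card := by exact_mod_cast Finset.card_pos.2 ⟨v, hv⟩
    have hn : (0 : ℝ) < (W ∪ R).card := by
      exact_mod_cast Finset.card_pos.2 ⟨v, Finset.mem_union_right _ hv⟩
    -- Detached, the child `u` is one of `R.card + 1` roots, to which the induction hypothesis
    -- applies; `card_forestMaps_ratio` converts back to the original forests.
    have key : ∀ u ∈ W, (R.card : ℝ) * ∑ f ∈ forestMaps W R,
        (if f u = v then (levelCard f u k : ℝ) else 0) ≤
        (R.card + k + 1) * (forestMaps W R).card / (W ∪ R).card := by
      intro u hu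
      have h1 := sum_forestMaps_root hd hu hv fun f => (levelCard f u k : ℝ)
      simp only [levelCard_update] at h1
      have h2 := ih _ _ (disjoint_erase_insert hd u) u (Finset.mem_insert_self u R)
      have h3 := card_forestMaps_ratio hd hu
      rw [Finset.card_insert_of_notMem (Finset.disjoint_left.1 hd hu)] at h2
      push_cast at h2
      rw [h1, le_div_iff₀ hn]
      set s := ∑ f ∈ forestMaps (W.erase u) (insert u R), (levelCard f u k : ℝ)
      set A := ((forestMaps W R).card : ℝ)
      set B := ((forestMaps (W.erase u) (insert u R)).card : ℝ)
      have h4 : ((R.card : ℝ) + 1) * (R.card * s * (W ∪ R).card) ≤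
          ((R.card : ℝ) + 1) * ((R.card + k + 1) * A) := by
        calc ((R.card : ℝ) + 1) * (R.card * s * (W ∪ R).card)
            = (R.card * (W ∪ R).card) * (((R.card : ℝ) + 1) * s) := by ring
          _ ≤ (R.card * (W ∪ R).card) * ((R.card + 1 + k) * B) := by gcongr
          _ = (R.card + k + 1) * (((R.card : ℝ) + 1) * A) := by rw [h3]; ring
          _ = _ := by ring
      exact le_of_mul_le_mul_left h4 (by positivity)
    calc (R.card : ℝ) * ∑ f ∈ forestMaps W R, (levelCard f v (k + 1) : ℝ)
        ≤ (R.card : ℝ) * ∑ f ∈ forestMaps W R, ∑ u ∈ W,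
            (if f u = v then (levelCard f u k : ℝ) else 0) := by
          gcongr with f hf
          exact_mod_cast levelCard_succ_le (mem_forestMaps.1 hf) k
      _ = ∑ u ∈ W, (R.card : ℝ) * ∑ f ∈ forestMaps W R,
            (if f u = v then (levelCard f u k : ℝ) else 0) := by
          rw [Finset.sum_comm, Finset.mul_sum]
      _ ≤ ∑ u ∈ W, ((R.card : ℝ) + k + 1) * (forestMaps W R).card / (W ∪ R).card :=
          Finset.sum_le_sum key
      _ = (W.card / (W ∪ R).card : ℝ) * ((R.card + k + 1) * (forestMaps W R).card) := by
          rw [Finset.sum_const, nsmul_eq_mul]; ring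
      _ ≤ 1 * ((R.card + k + 1) * (forestMaps W R).card) := by
          gcongr
          rw [div_le_one hn]
          exact_mod_cast Finset.card_le_card Finset.subset_union_left
      _ = _ := by push_cast; ring

/-- The sum of the distances to the root in a tree is also the sum of the sizes of the subtrees
above the vertices other than the root. -/
theorem IsForestMap.card_ancestors {r : α} (hf : IsForestMap W {r} f) (hr : r ∉ W) {x : α}
    (hx : x ∈ W ∨ x = r) : (W.filter fun u => x ∈ descendants f u).card = hitTime f x r := by
  have hd : Disjoint W {r} := Finset.disjoint_singleton_right.2 hr
  refine hf.induction (P := fun x => (W.filter fun u => x ∈ descendants f u).card = hitTime f x r)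
    ?_ ?_ (by simpa using hx)
  · intro z hz
    rw [Finset.mem_singleton] at hz
    subst hz
    rw [hitTime_self, Finset.card_eq_zero, Finset.filter_eq_empty_iff]
    intro u hu hzu
    exact hr ((mem_descendants.1 hzu).eq_of_fixed (hf.1 z hr) ▸ hu)
  · intro z hz ih
    have hreach : Reaches f (f z) r := by
      obtain ⟨v, hv, h⟩ := hf.2 z hz
      rw [Finset.mem_singleton] at hv
      subst hv
      exact h.of_ne fun h => hr (h ▸ hz)
    rw [hitTime_of_ne hreach fun h => hr (h ▸ hz), ← ih]
    have : (W.filter fun u => z ∈ descendants f u) =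
        insert z (W.filter fun u => f z ∈ descendants f u) := by
      ext u
      simp only [Finset.mem_filter, mem_descendants, Finset.mem_insert]
      constructor
      · rintro ⟨hu, hzu⟩
        by_cases h : z = u
        · exact Or.inl h.symm
        · exact Or.inr ⟨hu, hzu.of_ne h⟩
      · rintro (rfl | ⟨hu, hzu⟩)
        · exact ⟨hz, .refl _ _⟩
        · exact ⟨hu, hzu.head⟩
    rw [this, Finset.card_insert_of_notMem]
    simp only [Finset.mem_filter, mem_descendants, not_and]
    exact fun _ => hf.not_reaches hd hz

theorem IsForestMap.sum_card_descendants_eq {r : α} (hf : IsForestMap W {r} f) (hr : r ∉ W) :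
    ∑ u ∈ W, (descendants f u).card = ∑ x ∈ insert r W, hitTime f x r := by
  have h1 : ∀ u ∈ W, (descendants f u).card =
      ∑ x ∈ insert r W, if x ∈ descendants f u then 1 else 0 := by
    intro u hu
    rw [Finset.sum_ite_mem, Finset.sum_const, smul_eq_mul, mul_one]
    congr 1
    rw [eq_comm, Finset.inter_eq_right]
    have := hf.descendants_subset (Or.inl hu)
    rwa [Finset.union_comm, ← Finset.insert_eq] at this
  rw [Finset.sum_congr rfl h1, Finset.sum_comm]
  refine Finset.sum_congr rfl fun x hx => ?_
  rw [← hf.card_ancestors hr ((Finset.mem_insert.1 hx).symm), Finset.card_filter]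

/-- The mean distance to the root in a random tree of size `n` is at least of order `√n`. -/
theorem le_sum_hitTime {r : α} (hr : r ∉ W) {q : ℕ} (hq : 2 * q ^ 2 ≤ W.card + 1) :
    (q : ℝ) * (W.card + 1) / 2 * (forestMaps W {r}).card ≤
      ∑ f ∈ forestMaps W {r}, ∑ x ∈ insert r W, (hitTime f x r : ℝ) := by
  have hd : Disjoint W {r} := Finset.disjoint_singleton_right.2 hr
  have h1 : ∀ f ∈ forestMaps W {r}, (q : ℝ) * (W.card + 1) -
      q * ∑ k ∈ Finset.range q, (levelCard f r k : ℝ) ≤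
        ∑ x ∈ insert r W, (hitTime f x r : ℝ) := by
    intro f hf
    rw [mem_forestMaps] at hf
    have hmem : ∀ x ∈ insert r W, x ∈ descendants f r := by
      intro x hx
      rw [mem_descendants]
      rcases Finset.mem_insert.1 hx with rfl | hx
      · exact .refl _ _
      · obtain ⟨v, hv, h⟩ := hf.2 x hx
        rwa [Finset.mem_singleton.1 hv] at h
    have heq : descendants f r = insert r W := by
      refine Finset.Subset.antisymm ?_ hmem
      have := hf.descendants_subset (Or.inr (Finset.mem_singleton_self r))
      rwa [Finset.union_comm, ← Finset.insert_eq] at this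
    -- A depth is at least `q`, except for the vertices at the first `q` levels, where the lower
    -- bound is 0.
    have h2 : ∀ x ∈ insert r W, (q : ℝ) -
        q * (∑ k ∈ Finset.range q, if hitTime f x r = k then (1 : ℝ) else 0) ≤ hitTime f x r := by
      intro x _
      rw [Finset.sum_ite_eq]
      split_ifs with h
      · simp
      · rw [Finset.mem_range, not_lt] at h
        simpa using h
    have h3 := Finset.sum_le_sum h2
    refine le_trans (le_of_eq ?_) h3
    rw [Finset.sum_sub_distrib, Finset.sum_const, Finset.card_insert_of_notMem hr, nsmul_eq_mul,
      ← Finset.mul_sum, Finset.sum_comm]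
    push_cast
    rw [mul_comm]
    congr 2
    refine Finset.sum_congr rfl fun k _ => ?_
    rw [levelCard, Finset.card_filter]
    push_cast
    rw [heq]
  have h2 : ∀ k, ∑ f ∈ forestMaps W {r}, (levelCard f r k : ℝ) ≤
      (1 + k) * (forestMaps W {r}).card := fun k => by
    simpa using sum_levelCard_le k W {r} hd r (Finset.mem_singleton_self r)
  -- On average at most `q ^ 2` vertices lie below depth `q`, that is, at most half of them by `hq`.
  have h3 : ∑ k ∈ Finset.range q, ((1 : ℝ) + k) ≤ q ^ 2 := by
    calc ∑ k ∈ Finset.range q, ((1 : ℝ) + k) ≤ ∑ k ∈ Finset.range q, (q : ℝ) := by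
          refine Finset.sum_le_sum fun k hk => ?_
          rw [add_comm]
          exact_mod_cast Finset.mem_range.1 hk
      _ = q ^ 2 := by simp [sq]
  have hq' : 2 * (q : ℝ) ^ 2 ≤ W.card + 1 := by exact_mod_cast hq
  set A := ((forestMaps W {r}).card : ℝ)
  have hA : 0 ≤ A := Nat.cast_nonneg _
  calc (q : ℝ) * (W.card + 1) / 2 * A
      ≤ q * (W.card + 1) * A - q * (q ^ 2 * A) := by
        have : 0 ≤ (q : ℝ) * A * (W.card + 1 - 2 * q ^ 2) := by
          apply mul_nonneg (by positivity); linarith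
        nlinarith
    _ ≤ q * (W.card + 1) * A - q * ∑ k ∈ Finset.range q, (1 + k) * A := by
        rw [← Finset.sum_mul]
        gcongr
    _ ≤ q * (W.card + 1) * A - q * ∑ k ∈ Finset.range q, ∑ f ∈ forestMaps W {r},
          (levelCard f r k : ℝ) := by
        gcongr with k _
        exact h2 k
    _ = ∑ f ∈ forestMaps W {r}, ((q : ℝ) * (W.card + 1) -
          q * ∑ k ∈ Finset.range q, (levelCard f r k : ℝ)) := by
        rw [Finset.sum_sub_distrib, Finset.sum_const, nsmul_eq_mul, ← Finset.mul_sum,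
          Finset.sum_comm (s := Finset.range q)]
        ring
    _ ≤ _ := Finset.sum_le_sum h1

/-- The sum over the children of the root `r` of `s (n - s)`, with `s` the size of the subtree, has
the same mean as the sum of the distances to the root. -/
theorem sum_children_eq {r : α} (hr : r ∉ W) :
    ∑ f ∈ forestMaps W {r}, ∑ u ∈ W, (if f u = r then
      ((descendants f u).card : ℝ) * (W.card + 1 - (descendants f u).card) else 0) =
    ∑ f ∈ forestMaps W {r}, ∑ x ∈ insert r W, (hitTime f x r : ℝ) := by
  have hd : Disjoint W {r} := Finset.disjoint_singleton_right.2 hr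
  have hcard : ((W ∪ {r}).card : ℝ) = W.card + 1 := by
    rw [Finset.card_union_of_disjoint hd]; simp
  have h1 : ∀ f ∈ forestMaps W {r}, ∑ x ∈ insert r W, (hitTime f x r : ℝ) =
      ∑ u ∈ W, ((descendants f u).card : ℝ) := fun f hf => by
    exact_mod_cast ((mem_forestMaps.1 hf).sum_card_descendants_eq hr).symm
  rw [Finset.sum_congr rfl h1, Finset.sum_comm, Finset.sum_comm (t := W)]
  refine Finset.sum_congr rfl fun u hu => ?_
  -- Both sides become sums over forests with `u` detached. In `h2` the parent is forced to be `r`,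
  -- while in `h3` it has `n - s` choices, which produces the factor.
  have h2 := sum_forestMaps_root hd hu (Finset.mem_singleton_self r) fun f =>
    ((descendants f u).card : ℝ) * (W.card + 1 - (descendants f u).card)
  have h3 := sum_forestMaps_detach hd hu fun f _ => ((descendants f u).card : ℝ)
  simp only [descendants_update] at h2 h3
  rw [h2, h3]
  refine Finset.sum_congr rfl fun f hf => ?_
  rw [Finset.sum_const, nsmul_eq_mul, card_sdiff_descendants hu (mem_forestMaps.1 hf), hcard]
  ring

end Levels

/-! ### Conditioning on the vertex set of a subtree; fourth moment of the height -/

section Split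

variable {α : Type*} [Fintype α] {f g : α → α} {c : α}

theorem height_congr (h : ∀ z ∈ descendants f c, g z = f z)
    (hd : descendants g c = descendants f c) : height g c = height f c := by
  unfold height
  rw [hd]
  refine Finset.sup_congr rfl fun x hx => ?_
  have key : Reaches g x c ∧ hitTime g x c = hitTime f x c := by
    refine (mem_descendants.1 hx).induction
      (P := fun z => Reaches g z c ∧ hitTime g z c = hitTime f z c) ⟨.refl _ _, by simp⟩ ?_
    rintro z hz hr ⟨ih, ih'⟩
    have hgz := h z (mem_descendants.2 hr.head)
    rw [← hgz] at ih
    refine ⟨ih.head, ?_⟩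
    rw [hitTime_of_ne hr hz, hitTime_of_ne ih hz, hgz, ih']
  exact key.2

variable [DecidableEq α] {W R : Finset α}

theorem IsForestMap.restrict_descendants (hf : IsForestMap W R f) (hd : Disjoint W R)
    (hc : c ∈ R) : IsForestMap ((descendants f c).erase c) {c}
      fun x => if x ∈ descendants f c then f x else x := by
  refine ⟨fun x hx => ?_, fun x hx => ⟨c, Finset.mem_singleton_self c, ?_⟩⟩
  · dsimp only
    split_ifs with hxU
    · have : x = c := by
        by_contra h
        exact hx (Finset.mem_erase.2 ⟨h, hxU⟩)
      rw [this, hf.fixed hd hc]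
    · rfl
  · refine (mem_descendants.1 (Finset.mem_of_mem_erase hx)).induction
      (P := fun z => Reaches (fun x => if x ∈ descendants f c then f x else x) z c)
      (.refl _ _) ?_
    intro z _ hr ih
    apply Reaches.head
    rwa [if_pos (mem_descendants.2 hr.head)]

theorem IsForestMap.restrict_compl (hf : IsForestMap W R f) (c : α) :
    IsForestMap (W \ descendants f c) (R.erase c)
      fun x => if x ∈ descendants f c then x else f x := by
  refine ⟨fun x hx => ?_, fun x hx => ?_⟩
  · dsimp only
    split_ifs with hxU
    · rfl
    · exact hf.1 x fun h => hx (Finset.mem_sdiff.2 ⟨h, hxU⟩)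
  · rw [Finset.mem_sdiff] at hx
    refine hf.induction (P := fun z => z ∉ descendants f c → ∃ v ∈ R.erase c,
      Reaches (fun x => if x ∈ descendants f c then x else f x) z v) ?_ ?_ (Or.inl hx.1) hx.2
    · intro z hz hzc
      refine ⟨z, Finset.mem_erase.2 ⟨?_, hz⟩, .refl _ _⟩
      rintro rfl
      exact hzc (self_mem_descendants f z)
    · intro z _ ih hzc
      obtain ⟨v, hv, hr⟩ := ih fun h => hzc (mem_descendants.2 (mem_descendants.1 h).head)
      refine ⟨v, hv, Reaches.head ?_⟩
      rwa [if_neg hzc]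

/-- A tree on `U` and a forest on the complement do not interact: orbits started in either piece
stay there. This inverts the two restrictions above. -/
theorem IsForestMap.glue {h : α → α} {U : Finset α} (hcU : c ∈ U) (hU : U.erase c ⊆ W)
    (hc : c ∈ R) (hd : Disjoint W R) (hg : IsForestMap (U.erase c) {c} g)
    (hh : IsForestMap (W \ U) (R.erase c) h) :
    IsForestMap W R (fun x => if x ∈ U then g x else h x) ∧
      descendants (fun x => if x ∈ U then g x else h x) c = U := by
  set f : α → α := fun x => if x ∈ U then g x else h x
  have hin : ∀ z ∈ U, f z = g z := fun z hz => if_pos hz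
  have hout : ∀ z, z ∉ U → f z = h z := fun z hz => if_neg hz
  have hreach : ∀ x ∈ U, Reaches f x c := by
    intro x hx
    refine hg.induction (P := fun z => Reaches f z c) ?_ ?_ (x := x) ?_
    · intro z hz
      rw [Finset.mem_singleton] at hz
      exact hz ▸ .refl _ _
    · intro z hz ih
      apply Reaches.head
      rwa [hin z (Finset.mem_of_mem_erase hz)]
    · by_cases hxc : x = c
      · simp [hxc]
      · simp [hxc, hx]
  refine ⟨⟨fun x hx => ?_, fun x hx => ?_⟩, ?_⟩
  · by_cases hxU : x ∈ U
    · rw [hin x hxU]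
      exact hg.1 x fun hx' => hx (hU hx')
    · rw [hout x hxU]
      exact hh.1 x fun hx' => hx (Finset.sdiff_subset hx')
  · by_cases hxU : x ∈ U
    · exact ⟨c, hc, hreach x hxU⟩
    · refine hh.induction (P := fun z => ∃ v ∈ R, Reaches f z v) ?_ ?_
        (Or.inl (Finset.mem_sdiff.2 ⟨hx, hxU⟩))
      · exact fun z hz => ⟨z, Finset.mem_of_mem_erase hz, .refl _ _⟩
      · rintro z hz ⟨v, hv, hr⟩
        refine ⟨v, hv, Reaches.head ?_⟩
        rwa [hout z (Finset.mem_sdiff.1 hz).2]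
  · ext x
    rw [mem_descendants]
    refine ⟨fun hx => ?_, hreach x⟩
    refine hx.induction (P := fun z => z ∈ U) hcU ?_
    intro z _ _ hfz
    by_contra hz
    rw [hout z hz] at hfz
    by_cases hzW : z ∈ W \ U
    · have hdis : Disjoint (W \ U) (R.erase c) :=
        Finset.disjoint_of_subset_left Finset.sdiff_subset
          (Finset.disjoint_of_subset_right (Finset.erase_subset _ _) hd)
      rcases hh.apply_mem hdis hzW with h1 | h1
      · exact (Finset.mem_sdiff.1 h1).2 hfz
      · rw [Finset.mem_erase] at h1
        exact Finset.disjoint_right.1 hd h1.2 (hU (Finset.mem_erase.2 ⟨h1.1, hfz⟩))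
    · rw [hh.1 z hzW] at hfz
      exact hz hfz

/-- Given its set of vertices, a tree of a random forest is a uniform tree on it. -/
theorem sum_height_fiber (hd : Disjoint W R) (hc : c ∈ R) {U : Finset α} (hcU : c ∈ U)
    (hU : U.erase c ⊆ W) (ψ : ℕ → ℝ) :
    ∑ f ∈ (forestMaps W R).filter fun f => descendants f c = U, ψ (height f c) =
      (∑ g ∈ forestMaps (U.erase c) {c}, ψ (height g c)) *
        (forestMaps (W \ U) (R.erase c)).card := by
  have hrhs : (∑ g ∈ forestMaps (U.erase c) {c}, ψ (height g c)) *
      ((forestMaps (W \ U) (R.erase c)).card : ℝ) =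
      ∑ s ∈ forestMaps (U.erase c) {c} ×ˢ forestMaps (W \ U) (R.erase c),
        ψ (height s.1 c) := by
    rw [Finset.sum_product, Finset.sum_mul]
    refine Finset.sum_congr rfl fun g _ => ?_
    simp only [Finset.sum_const, nsmul_eq_mul, mul_comm]
  rw [hrhs]
  refine Finset.sum_bij'
    (fun f _ => (fun x => if x ∈ U then f x else x, fun x => if x ∈ U then x else f x))
    (fun s _ x => if x ∈ U then s.1 x else s.2 x) ?_ ?_ ?_ ?_ ?_
  · intro f hf
    simp only [Finset.mem_filter, mem_forestMaps] at hf
    obtain ⟨hf, rfl⟩ := hf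
    exact Finset.mem_product.2 ⟨mem_forestMaps.2 (hf.restrict_descendants hd hc),
      mem_forestMaps.2 (hf.restrict_compl c)⟩
  · rintro ⟨g, h⟩ hs
    simp only [Finset.mem_product, mem_forestMaps] at hs
    have := IsForestMap.glue hcU hU hc hd hs.1 hs.2
    exact Finset.mem_filter.2 ⟨mem_forestMaps.2 this.1, this.2⟩
  · intro f _
    funext x
    by_cases hx : x ∈ U <;> simp [hx]
  · rintro ⟨g, h⟩ hs
    simp only [Finset.mem_product, mem_forestMaps] at hs
    refine Prod.ext ?_ ?_ <;> funext x <;> by_cases hx : x ∈ U <;> simp only [hx, if_true, if_false]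
    · exact (hs.1.1 x fun h => hx (Finset.mem_of_mem_erase h)).symm
    · exact (hs.2.1 x fun h => (Finset.mem_sdiff.1 h).2 hx).symm
  · intro f hf
    simp only [Finset.mem_filter, mem_forestMaps] at hf
    obtain ⟨hf, rfl⟩ := hf
    congr 1
    refine (height_congr (fun z hz => if_pos hz) ?_).symm
    ext x
    rw [mem_descendants]
    constructor
    · intro hx
      by_contra hxU
      have := hx.eq_of_fixed (if_neg hxU)
      exact hxU (this ▸ self_mem_descendants f c)
    · intro hx
      refine (mem_descendants.1 hx).induction
        (P := fun z => Reaches (fun x => if x ∈ descendants f c then f x else x) z c)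
        (.refl _ _) ?_
      intro z _ hr ih
      apply Reaches.head
      rwa [if_pos (mem_descendants.2 hr.head)]

/-- Given its vertex set, the tree of `c` is uniform, so a moment bound for uniform trees applies
fiber by fiber. The weight may depend on the vertex set, to allow for the number of possible parents
of a detached vertex. -/
theorem sum_height_pow_le_of_subset (hd : Disjoint W R) (hc : c ∈ R) {C : ℝ}
    {w : Finset α → ℝ} (hw : ∀ U, 0 ≤ w U)
    (hC : ∀ V ⊆ W, ∑ g ∈ forestMaps V {c}, (height g c : ℝ) ^ 4 ≤
      C * (V.card + 1) ^ 2 * (forestMaps V {c}).card) :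
    ∑ f ∈ forestMaps W R, w (descendants f c) * (height f c : ℝ) ^ 4 ≤
      ∑ f ∈ forestMaps W R, w (descendants f c) * (C * ((descendants f c).card : ℝ) ^ 2) := by
  rw [← Finset.sum_fiberwise (forestMaps W R) (fun f => descendants f c),
    ← Finset.sum_fiberwise (forestMaps W R) (fun f => descendants f c)
      (fun f => w (descendants f c) * (C * ((descendants f c).card : ℝ) ^ 2))]
  refine Finset.sum_le_sum fun U _ => ?_
  rcases ((forestMaps W R).filter fun f => descendants f c = U).eq_empty_or_nonempty with he | ⟨f, hf⟩
  · rw [he, Finset.sum_empty, Finset.sum_empty]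
  rw [Finset.mem_filter, mem_forestMaps] at hf
  obtain ⟨hf, hfU⟩ := hf
  have hcU : c ∈ U := hfU ▸ self_mem_descendants f c
  have hU : U.erase c ⊆ W := by
    intro x hx
    rw [← hfU, Finset.mem_erase] at hx
    rcases Finset.mem_union.1 (hf.descendants_subset (Or.inr hc) hx.2) with h | h
    · exact h
    · exact absurd ((mem_descendants.1 hx.2).eq_of_fixed (hf.fixed hd h)) hx.1
  have h1 := sum_height_fiber hd hc hcU hU fun k => (k : ℝ) ^ 4
  have h2 := sum_height_fiber hd hc hcU hU fun _ => 1
  have h3 := hC _ hU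
  have h4 : ((U.erase c).card : ℝ) + 1 = U.card := by
    exact_mod_cast Finset.card_erase_add_one hcU
  rw [h4] at h3
  simp only [Finset.sum_const, nsmul_eq_mul, mul_one] at h2
  have hfib : ∀ ψ : (α → α) → ℝ,
      ∑ f ∈ (forestMaps W R).filter fun f => descendants f c = U, w (descendants f c) * ψ f =
        w U * ∑ f ∈ (forestMaps W R).filter fun f => descendants f c = U, ψ f := by
    intro ψ
    rw [Finset.mul_sum]
    exact Finset.sum_congr rfl fun f hf => by rw [(Finset.mem_filter.1 hf).2]
  rw [hfib, hfib, h1]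
  refine mul_le_mul_of_nonneg_left ?_ (hw U)
  calc _ ≤ C * (U.card : ℝ) ^ 2 * (forestMaps (U.erase c) {c}).card *
        (forestMaps (W \ U) (R.erase c)).card := by gcongr
    _ = C * (U.card : ℝ) ^ 2 * (((forestMaps W R).filter fun f => descendants f c = U).card) := by
        rw [h2]; ring
    _ = ∑ f ∈ (forestMaps W R).filter fun f => descendants f c = U, C * (U.card : ℝ) ^ 2 := by
        rw [Finset.sum_const, nsmul_eq_mul, mul_comm]
    _ = _ := by
        refine Finset.sum_congr rfl fun f hf => ?_
        rw [(Finset.mem_filter.1 hf).2]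

/-- A deepest vertex lies in the subtree of some child, whose height is at least that of the tree
minus one. The maximum over the children is bounded by the sum, and `K` tunes the cost of the
additional level. -/
theorem IsForestMap.height_pow_le {r : α} (hf : IsForestMap W {r} f) {K : ℝ} (hK : 0 < K) :
    (height f r : ℝ) ^ 4 ≤
      (1 + 1 / K) ^ 3 * ∑ u ∈ W, (if f u = r then (height f u : ℝ) ^ 4 else 0) +
        (1 + K) ^ 3 := by
  obtain ⟨x, hx, hxr⟩ := Finset.exists_mem_eq_sup (descendants f r) ⟨r, self_mem_descendants f r⟩
    fun x => hitTime f x r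
  rw [mem_descendants] at hx
  change height f r = _ at hxr
  have hsum : ∀ u ∈ W, (0 : ℝ) ≤ if f u = r then (height f u : ℝ) ^ 4 else 0 := by
    intro u _
    split_ifs <;> positivity
  by_cases hne : x = r
  · subst hne
    rw [hxr, hitTime_self]
    have := Finset.sum_nonneg hsum
    push_cast
    rw [zero_pow (by norm_num)]
    positivity
  · obtain ⟨u, hur, hfu, hxu, ht⟩ := hx.exists_last hne
    have huW : u ∈ W := by
      by_contra hu
      exact hur ((hf.1 u hu).symm.trans hfu)
    have hle : (height f r : ℝ) ≤ height f u + 1 := by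
      rw [hxr, ht]
      exact_mod_cast Nat.succ_le_succ (hitTime_le_height hxu)
    have h1 := Finset.single_le_sum hsum huW
    rw [if_pos hfu] at h1
    set M : ℝ := (height f u : ℝ)
    have hM : 0 ≤ M := Nat.cast_nonneg _
    -- Convexity of the fourth power, with `M + 1` the mean of `(1 + 1 / K) * M` and `1 + K` for the
    -- weights `K / (K + 1)` and `1 / (K + 1)`.
    have hconv : (M + 1) ^ 4 ≤ (1 + 1 / K) ^ 3 * M ^ 4 + (1 + K) ^ 3 := by
      have hK1 : (0 : ℝ) < K + 1 := by positivity
      have hcx : ConvexOn ℝ (Set.Ici 0) fun x : ℝ => x ^ 4 := convexOn_pow 4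
      have hj := hcx.2 (show (1 + 1 / K) * M ∈ Set.Ici 0 from Set.mem_Ici.2 (by positivity))
        (show 1 + K ∈ Set.Ici 0 from Set.mem_Ici.2 (by positivity))
        (show 0 ≤ K / (K + 1) by positivity) (show 0 ≤ 1 / (K + 1) by positivity) (by field_simp)
      simp only [smul_eq_mul] at hj
      have e1 : K / (K + 1) * ((1 + 1 / K) * M) + 1 / (K + 1) * (1 + K) = M + 1 := by
        field_simp
        ring
      have e2 : K / (K + 1) * ((1 + 1 / K) * M) ^ 4 + 1 / (K + 1) * (1 + K) ^ 4 =
          (1 + 1 / K) ^ 3 * M ^ 4 + (1 + K) ^ 3 := by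
        field_simp
        ring
      rwa [e1, e2] at hj
    calc (height f r : ℝ) ^ 4 ≤ (M + 1) ^ 4 := by gcongr
      _ ≤ _ := hconv
      _ ≤ _ := by gcongr

/-- The subtrees of different children of the root are disjoint. -/
theorem IsForestMap.sum_children_le {r : α} (hf : IsForestMap W {r} f) (hr : r ∉ W) :
    ∑ u ∈ W, (if f u = r then (descendants f u).card else 0) ≤ W.card + 1 := by
  rw [← Finset.sum_filter, ← Finset.card_biUnion]
  · rw [← Finset.card_insert_of_notMem hr]
    refine Finset.card_le_card fun x hx => ?_
    obtain ⟨u, hu, hxu⟩ := Finset.mem_biUnion.1 hx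
    have := hf.descendants_subset (Or.inl (Finset.mem_filter.1 hu).1) hxu
    rwa [Finset.union_comm, ← Finset.insert_eq] at this
  · have key : ∀ u ∈ W.filter (fun u => f u = r), ∀ v ∈ W.filter (fun u => f u = r),
        Reaches f u v → u = v := by
      intro u hu v hv h
      by_contra huv
      rw [Finset.mem_filter] at hu hv
      have h1 := h.of_ne huv
      rw [hu.2] at h1
      exact hr (h1.eq_of_fixed (hf.1 r hr) ▸ hv.1)
    intro u hu v hv huv
    rw [Function.onFun, Finset.disjoint_left]
    intro x hxu hxv
    obtain ⟨k, hk⟩ := mem_descendants.1 hxu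
    obtain ⟨l, hl⟩ := mem_descendants.1 hxv
    rcases le_total k l with hkl | hkl
    · refine huv (key u hu v hv ⟨l - k, ?_⟩)
      rw [← hk, ← Function.iterate_add_apply, Nat.sub_add_cancel hkl, hl]
    · refine huv (key v hv u hu ⟨k - l, ?_⟩).symm
      rw [← hl, ← Function.iterate_add_apply, Nat.sub_add_cancel hkl, hk]

/-- The induction step for the constant `C = 22781250 = 2 * 225 ^ 3`, with `K = 224 q` of order
`√n`. The factor `(1 + 1 / K) ^ 3` costs at most `C q n / 4`, half of the gain `C q n / 2`; the
other half covers `(1 + K) ^ 3 ≤ (225 q) ^ 3`. -/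
theorem height_recursion_bound {q n : ℝ} (hq : 1 ≤ q) (hn : 2 * q ^ 2 ≤ n) (hn' : n ≤ 8 * q ^ 2) :
    (1 + 1 / (224 * q)) ^ 3 * (22781250 * (n ^ 2 - q * n / 2)) + (1 + 224 * q) ^ 3 ≤
      22781250 * n ^ 2 := by
  have hq0 : 0 < q := by linarith
  have hn0 : 0 < n := by nlinarith
  set t := 1 / (224 * q) with ht
  have ht0 : 0 < t := by positivity
  have ht1 : t ≤ 1 := by
    rw [ht, div_le_one (by positivity)]; linarith
  have h1 : (1 + t) ^ 3 ≤ 1 + 7 * t := by nlinarith [mul_nonneg ht0.le (sub_nonneg.2 ht1)]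
  have h2 : 0 ≤ n ^ 2 - q * n / 2 := by nlinarith
  have h3 : 7 * t * n ^ 2 ≤ q * n / 4 := by
    rw [ht, show 7 * (1 / (224 * q)) * n ^ 2 = n ^ 2 / (32 * q) by field_simp; norm_num,
      div_le_iff₀ (by positivity)]
    nlinarith
  have h4 : (1 + 224 * q) ^ 3 ≤ (225 * q) ^ 3 := by gcongr; linarith
  have h5 : (225 * q) ^ 3 ≤ 11390625 * (q * n / 2) := by nlinarith
  have h6 : (1 + t) ^ 3 * (22781250 * (n ^ 2 - q * n / 2)) ≤
      (1 + 7 * t) * (22781250 * (n ^ 2 - q * n / 2)) := by gcongr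
  have h7 : 0 ≤ t * (q * n) := by positivity
  nlinarith

theorem exists_sqrt_half {n : ℕ} (hn : 2 ≤ n) : ∃ q : ℕ, 1 ≤ q ∧ 2 * q ^ 2 ≤ n ∧ n ≤ 8 * q ^ 2 := by
  refine ⟨Nat.sqrt (n / 2), ?_, ?_, ?_⟩
  · rw [Nat.le_sqrt]; omega
  · have := Nat.sqrt_le' (n / 2)
    omega
  · have h1 : 1 ≤ Nat.sqrt (n / 2) := by rw [Nat.le_sqrt]; omega
    have h2 := Nat.lt_succ_sqrt' (n / 2)
    have h3 : (Nat.sqrt (n / 2) + 1) ^ 2 ≤ 4 * Nat.sqrt (n / 2) ^ 2 := by nlinarith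
    rw [Nat.succ_eq_add_one] at h2
    omega

/-- The fourth moment of the height of a uniform tree with `n` vertices is at most of order
`n²`. -/
theorem sum_height_pow_le (W : Finset α) : ∀ r ∉ W,
    ∑ f ∈ forestMaps W {r}, (height f r : ℝ) ^ 4 ≤
      22781250 * (W.card + 1) ^ 2 * (forestMaps W {r}).card := by
  induction W using Finset.strongInduction with
  | H W ih =>
  intro r hr
  have hd : Disjoint W {r} := Finset.disjoint_singleton_right.2 hr
  rcases W.eq_empty_or_nonempty with rfl | hne
  -- There are no children here, and `K = 1` leaves only `(1 + 1) ^ 3 = 8`.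
  · calc ∑ f ∈ forestMaps ∅ {r}, (height f r : ℝ) ^ 4 ≤ ∑ f ∈ forestMaps ∅ {r}, (8 : ℝ) := by
          refine Finset.sum_le_sum fun f hf => ?_
          have := (mem_forestMaps.1 hf).height_pow_le (K := 1) one_pos
          norm_num at this
          exact this
      _ ≤ _ := by
          rw [Finset.sum_const, nsmul_eq_mul, mul_comm]
          gcongr
          norm_num
  obtain ⟨q, hq1, hq2, hq3⟩ := exists_sqrt_half (n := W.card + 1)
    (Nat.succ_le_succ (Finset.card_pos.2 hne))
  set A : ℝ := ((forestMaps W {r}).card : ℝ) with hA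
  set n : ℝ := (W.card : ℝ) + 1 with hn
  have hq1' : (1 : ℝ) ≤ q := by exact_mod_cast hq1
  have hq2' : 2 * (q : ℝ) ^ 2 ≤ n := by rw [hn]; exact_mod_cast hq2
  have hq3' : n ≤ 8 * (q : ℝ) ^ 2 := by rw [hn]; exact_mod_cast hq3
  -- The subtree of a child has fewer vertices, so the induction hypothesis applies to it given its
  -- vertex set.
  have hchild : ∑ f ∈ forestMaps W {r}, ∑ u ∈ W,
        (if f u = r then (height f u : ℝ) ^ 4 else 0) ≤
      ∑ f ∈ forestMaps W {r}, ∑ u ∈ W,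
        (if f u = r then 22781250 * ((descendants f u).card : ℝ) ^ 2 else 0) := by
    rw [Finset.sum_comm, Finset.sum_comm (t := W)]
    refine Finset.sum_le_sum fun u hu => ?_
    have h1 := sum_forestMaps_root hd hu (Finset.mem_singleton_self r)
      fun f => (height f u : ℝ) ^ 4
    have h2 := sum_forestMaps_root hd hu (Finset.mem_singleton_self r)
      fun f => 22781250 * ((descendants f u).card : ℝ) ^ 2
    simp only [height_update, descendants_update] at h1 h2
    rw [h1, h2]
    have h3 := sum_height_pow_le_of_subset (disjoint_erase_insert hd u)
      (Finset.mem_insert_self _ _) (w := fun _ => 1) (fun _ => zero_le_one)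
      (C := 22781250) fun V hV => ?_
    · simpa using h3
    exact ih V (hV.trans_ssubset (Finset.erase_ssubset hu)) u fun h =>
      Finset.notMem_erase u W (hV h)
  -- Write `s ^ 2 = n * s - s * (n - s)`: the first part sums to at most `n ^ 2`, the second has the
  -- mean of the sum of the depths.
  have hsq : ∑ f ∈ forestMaps W {r}, ∑ u ∈ W,
      (if f u = r then 22781250 * ((descendants f u).card : ℝ) ^ 2 else 0) ≤
      22781250 * (n ^ 2 - q * n / 2) * A := by
    have h1 := le_sum_hitTime hr hq2
    rw [← sum_children_eq hr] at h1
    have h2 : ∑ f ∈ forestMaps W {r}, ∑ u ∈ W,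
        (if f u = r then ((descendants f u).card : ℝ) else 0) ≤ n * A := by
      rw [mul_comm, hA, ← nsmul_eq_mul, ← Finset.sum_const]
      refine Finset.sum_le_sum fun f hf => ?_
      rw [hn]
      exact_mod_cast (mem_forestMaps.1 hf).sum_children_le hr
    have h3 : ∑ f ∈ forestMaps W {r}, ∑ u ∈ W,
        (if f u = r then 22781250 * ((descendants f u).card : ℝ) ^ 2 else 0) =
        22781250 * (n * ∑ f ∈ forestMaps W {r}, ∑ u ∈ W,
          (if f u = r then ((descendants f u).card : ℝ) else 0) -
        ∑ f ∈ forestMaps W {r}, ∑ u ∈ W, (if f u = r then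
          ((descendants f u).card : ℝ) * (W.card + 1 - (descendants f u).card) else 0)) := by
      simp only [Finset.mul_sum, ← Finset.sum_sub_distrib]
      refine Finset.sum_congr rfl fun f _ => Finset.sum_congr rfl fun u _ => ?_
      split_ifs
      · rw [hn]; ring
      · simp
    have hn0 : 0 ≤ n := by positivity
    rw [h3]
    have h4 := mul_le_mul_of_nonneg_left h2 hn0
    have h5 : (q : ℝ) * n / 2 * A ≤ ∑ f ∈ forestMaps W {r}, ∑ u ∈ W, (if f u = r then
          ((descendants f u).card : ℝ) * (W.card + 1 - (descendants f u).card) else 0) := h1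
    nlinarith
  have hK : (0 : ℝ) < 224 * q := by positivity
  calc ∑ f ∈ forestMaps W {r}, (height f r : ℝ) ^ 4
      ≤ ∑ f ∈ forestMaps W {r}, ((1 + 1 / (224 * (q : ℝ))) ^ 3 *
          ∑ u ∈ W, (if f u = r then (height f u : ℝ) ^ 4 else 0) + (1 + 224 * (q : ℝ)) ^ 3) :=
        Finset.sum_le_sum fun f hf => (mem_forestMaps.1 hf).height_pow_le hK
    _ = (1 + 1 / (224 * (q : ℝ))) ^ 3 * ∑ f ∈ forestMaps W {r},
          ∑ u ∈ W, (if f u = r then (height f u : ℝ) ^ 4 else 0) +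
          (1 + 224 * (q : ℝ)) ^ 3 * A := by
        rw [Finset.sum_add_distrib, Finset.mul_sum, Finset.sum_const, nsmul_eq_mul,
          mul_comm A]
    _ ≤ (1 + 1 / (224 * (q : ℝ))) ^ 3 * (22781250 * (n ^ 2 - q * n / 2) * A) +
          (1 + 224 * (q : ℝ)) ^ 3 * A := by
        gcongr
        exact hchild.trans hsq
    _ = ((1 + 1 / (224 * (q : ℝ))) ^ 3 * (22781250 * (n ^ 2 - q * n / 2)) +
          (1 + 224 * (q : ℝ)) ^ 3) * A := by ring
    _ ≤ _ := by
        gcongr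
        exact height_recursion_bound hq1' hq2' hq3'

end Split

/-! ### Fourth powers of the heights of all subtrees -/

section TotalHeight

variable {α : Type*} [Fintype α] [DecidableEq α] {W : Finset α} {r : α}

theorem le_sqrt_add_pow_div (h : ℝ) {s : ℝ} (hh : 0 ≤ h) (hs : 0 < s) : h ≤ s + h ^ 4 / s ^ 3 := by
  rcases le_total h s with hle | hle
  · have : 0 ≤ h ^ 4 / s ^ 3 := by positivity
    linarith
  · have : h ≤ h ^ 4 / s ^ 3 := by
      rw [le_div_iff₀ (by positivity)]
      calc h * s ^ 3 ≤ h * h ^ 3 := by gcongr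
        _ = h ^ 4 := by ring
    linarith

/-- After cutting above `u`, each forest is weighted by the number of possible parents, which
depends only on the vertex set of the subtree. -/
theorem sum_height_subtree_pow_le (hr : r ∉ W) {u : α} (hu : u ∈ W) :
    ∑ f ∈ forestMaps W {r}, (height f u : ℝ) ^ 4 ≤
      ∑ f ∈ forestMaps W {r}, 22781250 * ((descendants f u).card : ℝ) ^ 2 := by
  have hd : Disjoint W {r} := Finset.disjoint_singleton_right.2 hr
  have h1 := sum_forestMaps_detach hd hu fun f _ => (height f u : ℝ) ^ 4
  have h2 := sum_forestMaps_detach hd hu fun f _ =>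
    22781250 * ((descendants f u).card : ℝ) ^ 2
  simp only [height_update, descendants_update, Finset.sum_const, nsmul_eq_mul] at h1 h2
  rw [h1, h2]
  refine sum_height_pow_le_of_subset (disjoint_erase_insert hd u) (Finset.mem_insert_self _ _)
    (w := fun U => (((W ∪ {r}) \ U).card : ℝ)) (fun _ => Nat.cast_nonneg _) fun V hV => ?_
  exact sum_height_pow_le V u fun h => Finset.notMem_erase u W (hV h)

theorem sum_height_le (hr : r ∉ W) :
    ∑ f ∈ forestMaps W {r}, (height f r : ℝ) ≤
      22781251 * √(W.card + 1 : ℝ) * (forestMaps W {r}).card := by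
  have hn : (0 : ℝ) < W.card + 1 := by positivity
  set s := √(W.card + 1 : ℝ) with hs
  have hs0 : 0 < s := Real.sqrt_pos.2 hn
  have hss : (W.card + 1 : ℝ) = s ^ 2 := (Real.sq_sqrt hn.le).symm
  have h1 := sum_height_pow_le W r hr
  rw [hss] at h1
  calc ∑ f ∈ forestMaps W {r}, (height f r : ℝ)
      ≤ ∑ f ∈ forestMaps W {r}, (s + (height f r : ℝ) ^ 4 / s ^ 3) :=
        Finset.sum_le_sum fun f _ => le_sqrt_add_pow_div _ (Nat.cast_nonneg _) hs0
    _ = s * (forestMaps W {r}).card +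
          (∑ f ∈ forestMaps W {r}, (height f r : ℝ) ^ 4) / s ^ 3 := by
        rw [Finset.sum_add_distrib, Finset.sum_const, nsmul_eq_mul, Finset.sum_div]
        ring
    _ ≤ s * (forestMaps W {r}).card +
          (22781250 * (s ^ 2) ^ 2 * (forestMaps W {r}).card) / s ^ 3 :=
        add_le_add le_rfl (div_le_div_of_nonneg_right h1 (pow_pos hs0 3).le)
    _ = _ := by
        have hC : ∀ C A : ℝ, s * A + (C * (s ^ 2) ^ 2 * A) / s ^ 3 = (C + 1) * s * A := by
          intro C A
          field_simp
          ring
        rw [hC]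
        norm_num

/-- The fourth powers of the heights of all the subtrees of a uniform tree with `n` vertices have
a mean sum at most of order `n² √n`. -/
theorem sum_sum_height_pow_le (hr : r ∉ W) :
    ∑ f ∈ forestMaps W {r}, ∑ u ∈ insert r W, ((height f u : ℝ) + 1) ^ 4 ≤
      8 * 22781251 ^ 2 * ((W.card + 1) ^ 2 * √(W.card + 1 : ℝ)) * (forestMaps W {r}).card := by
  set n : ℝ := (W.card : ℝ) + 1 with hn
  have hn1 : 1 ≤ n := by rw [hn]; linarith [(Nat.cast_nonneg W.card : (0 : ℝ) ≤ W.card)]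
  have hs1 : 1 ≤ √n := Real.one_le_sqrt.2 hn1
  set A : ℝ := ((forestMaps W {r}).card : ℝ) with hA
  have hA0 : 0 ≤ A := Nat.cast_nonneg _
  have hcard : ∀ f ∈ forestMaps W {r}, ∀ u ∈ W, ((descendants f u).card : ℝ) ≤ n := by
    intro f hf u hu
    have := Finset.card_le_card ((mem_forestMaps.1 hf).descendants_subset (Or.inl hu))
    rw [Finset.union_comm, ← Finset.insert_eq, Finset.card_insert_of_notMem hr] at this
    rw [hn]
    exact_mod_cast this
  -- Bound `s ^ 2` by `n * s`; the sizes `s` add up to the sum of the depths, at most `n` times the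
  -- height.
  have hinner : ∀ f ∈ forestMaps W {r}, ∑ u ∈ W, 22781250 * ((descendants f u).card : ℝ) ^ 2 ≤
      22781250 * n ^ 2 * height f r := by
    intro f hf
    have hf' := mem_forestMaps.1 hf
    calc ∑ u ∈ W, 22781250 * ((descendants f u).card : ℝ) ^ 2
        ≤ ∑ u ∈ W, 22781250 * n * ((descendants f u).card : ℝ) := by
          refine Finset.sum_le_sum fun u hu => ?_
          have := hcard f hf u hu
          rw [sq, mul_assoc]
          gcongr
      _ = 22781250 * n * ∑ x ∈ insert r W, (hitTime f x r : ℝ) := by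
          rw [← Finset.mul_sum]
          congr 1
          exact_mod_cast hf'.sum_card_descendants_eq hr
      _ ≤ 22781250 * n * ∑ x ∈ insert r W, (height f r : ℝ) := by
          gcongr with x hx
          apply hitTime_le_height
          rcases Finset.mem_insert.1 hx with rfl | hx
          · exact .refl _ _
          · obtain ⟨v, hv, h⟩ := hf'.2 x hx
            rwa [Finset.mem_singleton.1 hv] at h
      _ = 22781250 * n ^ 2 * height f r := by
          rw [Finset.sum_const, Finset.card_insert_of_notMem hr, nsmul_eq_mul]
          push_cast
          ring
  have h1 : ∑ f ∈ forestMaps W {r}, ∑ u ∈ W, (height f u : ℝ) ^ 4 ≤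
      22781250 * n ^ 2 * (22781251 * √n * A) := by
    calc ∑ f ∈ forestMaps W {r}, ∑ u ∈ W, (height f u : ℝ) ^ 4
        ≤ ∑ f ∈ forestMaps W {r}, ∑ u ∈ W, 22781250 * ((descendants f u).card : ℝ) ^ 2 := by
          rw [Finset.sum_comm, Finset.sum_comm (t := W)]
          exact Finset.sum_le_sum fun u hu => sum_height_subtree_pow_le hr hu
      _ ≤ ∑ f ∈ forestMaps W {r}, 22781250 * n ^ 2 * (height f r : ℝ) :=
          Finset.sum_le_sum hinner
      _ ≤ _ := by
          rw [← Finset.mul_sum]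
          have := sum_height_le hr
          gcongr
  have h2 := sum_height_pow_le W r hr
  have h3 : ∀ h : ℝ, (h + 1) ^ 4 ≤ 8 * (h ^ 4 + 1) := fun h => by
    nlinarith [sq_nonneg (h - 1), sq_nonneg (h ^ 2 - 1), sq_nonneg (h ^ 2 - h), sq_nonneg (h + 1)]
  calc ∑ f ∈ forestMaps W {r}, ∑ u ∈ insert r W, ((height f u : ℝ) + 1) ^ 4
      ≤ ∑ f ∈ forestMaps W {r}, ∑ u ∈ insert r W, 8 * ((height f u : ℝ) ^ 4 + 1) :=
        Finset.sum_le_sum fun f _ => Finset.sum_le_sum fun u _ => h3 _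
    _ = 8 * (∑ f ∈ forestMaps W {r}, ∑ u ∈ W, (height f u : ℝ) ^ 4 +
          ∑ f ∈ forestMaps W {r}, (height f r : ℝ) ^ 4 + n * A) := by
        simp only [← Finset.mul_sum, Finset.sum_add_distrib, Finset.sum_insert hr,
          Finset.sum_const, nsmul_eq_mul]
        rw [hn, hA]
        ring
    _ ≤ 8 * (22781250 * n ^ 2 * (22781251 * √n * A) + 22781250 * n ^ 2 * A * √n +
          n * A * (n * √n)) := by
        have h4 : ∑ f ∈ forestMaps W {r}, (height f r : ℝ) ^ 4 ≤ 22781250 * n ^ 2 * A * √n :=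
          h2.trans (le_mul_of_one_le_right (by positivity) hs1)
        have h5 : n * A ≤ n * A * (n * √n) :=
          le_mul_of_one_le_right (by positivity) (one_le_mul_of_one_le_of_one_le hn1 hs1)
        exact mul_le_mul_of_nonneg_left (add_le_add (add_le_add h1 h4) h5) (by norm_num)
    -- With `C = 22781250`, the three terms add up to `C * (C + 1) + C + 1 = (C + 1) ^ 2`.
    _ ≤ _ := by
        have : 0 ≤ n ^ 2 * √n * A := by positivity
        nlinarith

end TotalHeight

/-! ### Deterministic bound on the length of a saop -/

/-- If each term is at most half of one of the four preceding ones, then the sum is controlled by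
the largest term. -/
theorem sum_le_of_half_le {g : ℕ → ℝ} {B : ℝ} (N : ℕ) (hB0 : 0 ≤ B) (hB : ∀ i < N, g i ≤ B)
    (h : ∀ i, i + 4 < N → ∃ j < 4, 2 * g (i + 4) ≤ g (i + j)) :
    ∑ i ∈ Finset.range N, g i ≤ 16 * B := by
  -- The ratio 7/8 works because `(7 / 8) ^ 4 ≥ 1 / 2`; the factor 2 covers the first four terms, as
  -- `2 * (7 / 8) ^ 3 ≥ 1`.
  have key : ∀ i, i < N → g i ≤ 2 * B * (7 / 8) ^ i := by
    intro i
    induction i using Nat.strong_induction_on with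
    | _ i ih =>
    intro hi
    rcases lt_or_ge i 4 with hi4 | hi4
    · have h1 : ((7 : ℝ) / 8) ^ 3 ≤ (7 / 8) ^ i :=
        pow_le_pow_of_le_one (by norm_num) (by norm_num) (by omega)
      have h2 := hB i hi
      nlinarith
    · obtain ⟨i, rfl⟩ := Nat.exists_eq_add_of_le' hi4
      obtain ⟨j, hj, hle⟩ := h i hi
      have h1 := ih (i + j) (by omega) (by omega)
      have h2 : ((7 : ℝ) / 8) ^ (i + j) ≤ (7 / 8) ^ i :=
        pow_le_pow_of_le_one (by norm_num) (by norm_num) (by omega)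
      have h3 : 0 < ((7 : ℝ) / 8) ^ i := by positivity
      have h4 : 2 * B * (7 / 8) ^ (i + j) ≤ 2 * B * (7 / 8) ^ i := by gcongr
      rw [pow_add]
      have h5 : 0 ≤ B * (7 / 8 : ℝ) ^ i := by positivity
      nlinarith
  calc ∑ i ∈ Finset.range N, g i ≤ ∑ i ∈ Finset.range N, 2 * B * (7 / 8) ^ i :=
        Finset.sum_le_sum fun i hi => key i (Finset.mem_range.1 hi)
    _ = 2 * B * ∑ i ∈ Finset.range N, (7 / 8 : ℝ) ^ i := by rw [Finset.mul_sum]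
    _ ≤ 2 * B * 8 := by
        gcongr
        rw [geom_sum_eq (by norm_num)]
        have : (0 : ℝ) ≤ (7 / 8) ^ N := by positivity
        rw [div_le_iff_of_neg (by norm_num)]
        linarith
    _ = 16 * B := by ring

section Saop

variable {α : Type*} [Fintype α] {f : α → α}

/-- From the end of the edge `e`, iterating `f` leads to the origin of the edge `e'` from below. -/
def LeadsTo (f : α → α) (e' e : α × α) : Prop :=
  ∃ l, l ≤ height f e'.1 ∧ f^[l] e.2 = e'.1

/-- The hypothesis `h` makes the `l` iterations genuine steps: without it they could idle at the
fixed root. -/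
theorem le_height_of_iterate {r x y : α} {l : ℕ} (hy : Reaches f y r) (hx : f^[l] x = y)
    (h : hitTime f y r + l ≤ hitTime f x r) : l ≤ height f y := by
  refine le_trans ?_ (hitTime_le_height ⟨l, hx⟩)
  have := hitTime_le_add hy (iterate_hitTime (v := y) ⟨l, hx⟩)
  omega

/-- A walk in the union of a tree oriented toward its root and of a set of edges `E`, with different
edges, decomposes into tree segments joined by a chain of different edges of `E`. -/
theorem exists_chain_of_walk {r : α} (hf : ∀ x, Reaches f x r) {E : Set (α × α)} {v : ℕ → α}
    (k : ℕ) (hstep : ∀ i < k, (v i ≠ r ∧ f (v i) = v (i + 1)) ∨ (v i, v (i + 1)) ∈ E)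
    (hinj : ∀ i < k, ∀ j < k, (v i, v (i + 1)) = (v j, v (j + 1)) → i = j) :
    ∃ l : List (α × α), l.Nodup ∧ (∀ e ∈ l, e ∈ E) ∧ l.IsChain (LeadsTo f) ∧
      (∀ e ∈ l, ∃ i < k, e = (v i, v (i + 1))) ∧
      ∃ s j, f^[j] s = v k ∧ hitTime f (v k) r + j ≤ hitTime f s r ∧
        (∀ e ∈ l.head?, e.2 = s) ∧ k ≤ (l.map fun e => height f e.1 + 1).sum + j := by
  induction k with
  -- The list holds the latest edge first; `s` is the start of the current tree segment and `j` its
  -- length so far.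
  | zero => exact ⟨[], by simp, by simp, by simp, by simp, v 0, 0, rfl, le_rfl, by simp, by simp⟩
  | succ k ih =>
    obtain ⟨l, hnd, hE, hch, hed, s, j, hj, hjt, hhd, hk⟩ :=
      ih (fun i hi => hstep i (by omega)) fun i hi j hj => hinj i (by omega) j (by omega)
    rcases hstep k k.lt_succ_self with ⟨hne, hfv⟩ | hEk
    · refine ⟨l, hnd, hE, hch, fun e he => ?_, s, j + 1, ?_, ?_, hhd, by omega⟩
      · obtain ⟨i, hi, h⟩ := hed e he
        exact ⟨i, by omega, h⟩
      · rw [Function.iterate_succ_apply', hj, hfv]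
      · have := hitTime_of_ne (hf (f (v k))) hne
        rw [hfv] at this
        omega
    · refine ⟨(v k, v (k + 1)) :: l, ?_, ?_, ?_, ?_, v (k + 1), 0, rfl, le_rfl, by simp, ?_⟩
      · rw [List.nodup_cons]
        refine ⟨fun hmem => ?_, hnd⟩
        obtain ⟨i, hi, h⟩ := hed _ hmem
        exact hi.ne' (hinj k k.lt_succ_self i (by omega) h)
      · intro e he
        rcases List.mem_cons.1 he with rfl | he
        exacts [hEk, hE e he]
      · rw [List.isChain_cons]
        refine ⟨fun e he => ⟨j, ?_, ?_⟩, hch⟩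
        · exact le_height_of_iterate (hf _) hj hjt
        · rw [hhd e he, hj]
      · intro e he
        rcases List.mem_cons.1 he with rfl | he
        · exact ⟨k, k.lt_succ_self, rfl⟩
        · obtain ⟨i, hi, h⟩ := hed e he
          exact ⟨i, by omega, h⟩
      · have := le_height_of_iterate (hf _) hj hjt
        simp only [List.map_cons, List.sum_cons]
        omega

/-- Five edges that a walk uses one after the other: the first starts at `a`, they end at the
vertices `b i`, and after each of the first four the walk goes `l i` steps toward the root. -/
def jumpChain (f : α → α) (a : α) (b : Fin 5 → α) (l : Fin 4 → ℕ) (j : Fin 5) : α × α :=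
  (Fin.cases a (fun i => f^[l i] (b i.castSucc)) j, b j)

/-- `E` has five different edges that a walk may use one after the other without going through long
tree segments in between. -/
def HasShortJumps (f : α → α) (E : Set (α × α)) : Prop :=
  ∃ (a : α) (b : Fin 5 → α) (l : Fin 4 → Fin (2 * (height f a + 1))),
    Function.Injective (jumpChain f a b fun i => l i) ∧
      ∀ j, jumpChain f a b (fun i => l i) j ∈ E

/-- Otherwise the four edges that follow `l[i + 4]` on the walk start at subtrees less than twice as
high (counting `height + 1`), so the segments leading to them are short and the five edges are
forbidden by `hE`. -/
theorem exists_half_le_of_chain {E : Set (α × α)} (hE : ¬ HasShortJumps f E) {l : List (α × α)}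
    (hnd : l.Nodup) (hlE : ∀ e ∈ l, e ∈ E) (hch : l.IsChain (LeadsTo f)) {i : ℕ}
    (hi : i + 4 < l.length) : ∃ (j : ℕ) (hj : j < 4),
      2 * (height f l[i + 4].1 + 1) ≤ height f l[i + j].1 + 1 := by
  by_contra! hcon
  apply hE
  have hlead : ∀ q : Fin 4, ∃ t, t ≤ height f (l[i + 3 - q]'(by omega)).1 ∧
      f^[t] (l[i + 4 - q]'(by omega)).2 = (l[i + 3 - q]'(by omega)).1 := by
    intro q
    have := List.isChain_iff_getElem.1 hch (i + 3 - q) (by omega)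
    have he : i + 3 - (q : ℕ) + 1 = i + 4 - q := by omega
    simp only [he] at this
    exact this
  choose t ht htf using hlead
  have hlt : ∀ q : Fin 4, t q < 2 * (height f l[i + 4].1 + 1) := by
    intro q
    have h1 := hcon (3 - q) (by omega)
    have he : i + (3 - (q : ℕ)) = i + 3 - q := by omega
    simp only [he] at h1
    have h2 := ht q
    omega
  -- Indices decrease because the list runs backward along the walk: `l[i + 4]` is the earliest of
  -- the five edges.
  refine ⟨l[i + 4].1, fun j => (l[i + 4 - j]'(by omega)).2, fun q => ⟨t q, hlt q⟩, ?_⟩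
  have heq : ∀ j : Fin 5, jumpChain f l[i + 4].1 (fun j => (l[i + 4 - j]'(by omega)).2)
      (fun q => t q) j = l[i + 4 - j]'(by omega) := by
    intro j
    refine Fin.cases ?_ (fun q => ?_) j
    · simp [jumpChain]
    · refine Prod.ext ?_ rfl
      simp only [jumpChain, Fin.cases_succ]
      have he : i + 4 - ((q.succ : Fin 5) : ℕ) = i + 3 - q := by
        rw [Fin.val_succ]; omega
      simp only [he]
      exact htf q
  constructor
  · intro j j' hjj
    dsimp only at hjj
    rw [heq, heq, hnd.getElem_inj_iff] at hjj
    ext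
    omega
  · intro j
    dsimp only
    rw [heq]
    exact hlE _ (List.getElem_mem _)

theorem le_of_isSaop {r : α} (hf : ∀ x, Reaches f x r) {E : Set (α × α)} {G : Digraph α}
    (hG : ∀ u v, G.Adj u v → (u ≠ r ∧ f u = v) ∨ (u, v) ∈ E) {B : ℝ} (hB0 : 0 ≤ B)
    (hB : ∀ e ∈ E, (height f e.1 : ℝ) + 1 ≤ B) (hE : ¬ HasShortJumps f E) {k : ℕ}
    {v : Fin (k + 1) → α} (hv : IsSaop G v) : (k : ℝ) ≤ height f r + 16 * B := by
  -- The walk is extended to all of `ℕ` by staying at its last vertex; only the indices up to `k`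
  -- matter.
  set w : ℕ → α := fun i => v ⟨min i k, by omega⟩
  have hw1 : ∀ i (hi : i < k), w i = v (Fin.castSucc ⟨i, hi⟩) := fun i hi => by
    refine congrArg v (Fin.ext ?_)
    simp [hi.le]
  have hw2 : ∀ i (hi : i < k), w (i + 1) = v (Fin.succ ⟨i, hi⟩) := fun i hi => by
    refine congrArg v (Fin.ext ?_)
    simp [Nat.succ_le_of_lt hi]
  obtain ⟨l, hnd, hlE, hch, -, s, j, hj, hjt, -, hk⟩ := exists_chain_of_walk hf (E := E) (v := w) k
    (fun i hi => hG _ _ (by rw [hw1 i hi, hw2 i hi]; exact hv.1 ⟨i, hi⟩))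
    (fun i hi j hj h => by
      rw [hw1 i hi, hw2 i hi, hw1 j hj, hw2 j hj] at h
      exact congrArg Fin.val (hv.2 h))
  have hjr : j ≤ height f r := by
    have := hitTime_le_height (hf s)
    omega
  set g : ℕ → ℝ := fun i => if hi : i < l.length then (height f l[i].1 : ℝ) + 1 else 0
  have hgi : ∀ i (hi : i < l.length), g i = (height f l[i].1 : ℝ) + 1 := fun i hi => dif_pos hi
  have hsum : (((l.map fun e => height f e.1 + 1).sum : ℕ) : ℝ) =
      ∑ i ∈ Finset.range l.length, g i := by
    rw [← Fin.sum_univ_eq_sum_range, ← Fin.sum_univ_fun_getElem]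
    push_cast
    exact Finset.sum_congr rfl fun i _ => (hgi i i.2).symm
  have hle := sum_le_of_half_le (g := g) l.length hB0
    (fun i hi => by rw [hgi i hi]; exact hB _ (hlE _ (List.getElem_mem _)))
    (fun i hi => by
      obtain ⟨j, hj, h⟩ := exists_half_le_of_chain hE hnd hlE hch hi
      refine ⟨j, hj, ?_⟩
      rw [hgi _ hi, hgi _ (by omega)]
      exact_mod_cast h)
  have hk' : (k : ℝ) ≤ ((l.map fun e => height f e.1 + 1).sum : ℕ) + j := by exact_mod_cast hk
  have hjr' : (j : ℝ) ≤ height f r := by exact_mod_cast hjr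
  linarith

theorem longestSaop_le {r : α} (hf : ∀ x, Reaches f x r) {E : Set (α × α)} {G : Digraph α}
    (hG : ∀ u v, G.Adj u v → (u ≠ r ∧ f u = v) ∨ (u, v) ∈ E) {B : ℝ} (hB0 : 0 ≤ B)
    (hB : ∀ e ∈ E, (height f e.1 : ℝ) + 1 ≤ B) (hE : ¬ HasShortJumps f E) :
    (longestSaop G : ℝ) ≤ height f r + 16 * B := by
  have : Nonempty α := ⟨r⟩
  obtain ⟨v, hv⟩ := Nat.sSup_mem (saopLengths_nonempty G) (bddAbove_saopLengths G)
  exact le_of_isSaop hf hG hB0 hB hE hv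

end Saop

/-! ### Trees and parent maps -/

section TreeParentMaps

variable {α : Type*} [Fintype α] [DecidableEq α] {r : α} {f : α → α}

theorem reaches_root (hf : IsForestMap (Finset.univ.erase r) {r} f) (x : α) : Reaches f x r := by
  by_cases hx : x = r
  · exact hx ▸ .refl _ _
  · obtain ⟨v, hv, h⟩ := hf.2 x (Finset.mem_erase.2 ⟨hx, Finset.mem_univ _⟩)
    rwa [Finset.mem_singleton.1 hv] at h

/-- A tree, oriented toward its root, is given by the parent map of a forest with one root. -/
theorem exists_parentMap {T : SimpleGraph α} (hT : T.IsTree) (r : α) :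
    ∃ f ∈ forestMaps (Finset.univ.erase r) {r},
      (∀ u v, T.Adj u v ↔ (u ≠ r ∧ f u = v) ∨ (v ≠ r ∧ f v = u)) ∧
      ∀ u v, (orientToRoot T r).Adj u v → u ≠ r ∧ f u = v := by
  classical
  have hex : ∀ u, ∃ v, (u = r → v = r) ∧ (u ≠ r → T.Adj u v ∧ T.dist v r < T.dist u r) := by
    intro u
    by_cases hu : u = r
    · exact ⟨r, fun _ => rfl, fun h => absurd hu h⟩
    · obtain ⟨p, hp⟩ := hT.1.exists_walk_length_eq_dist u r
      cases p with
      | nil => exact absurd rfl hu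
      | @cons _ v _ h q =>
        refine ⟨v, fun h => absurd h hu, fun _ => ⟨h, ?_⟩⟩
        rw [← hp, SimpleGraph.Walk.length_cons]
        exact Nat.lt_succ_of_le (SimpleGraph.dist_le q)
  choose f hfr hf using hex
  have hdesc : ∀ d u, T.dist u r = d → Reaches f u r := by
    intro d
    induction d using Nat.strong_induction_on with
    | _ d ih =>
    intro u hu
    by_cases hur : u = r
    · exact hur ▸ .refl _ _
    · exact (ih _ (hu ▸ (hf u hur).2) (f u) rfl).head
  have hinj : Set.InjOn (fun u => s(u, f u)) (Finset.univ.erase r : Finset α) := by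
    intro u hu v hv huv
    rw [Finset.mem_coe, Finset.mem_erase] at hu hv
    rcases Sym2.eq_iff.1 huv with h | h
    · exact h.1
    · have h1 := (hf u hu.1).2
      have h2 := (hf v hv.1).2
      rw [h.2] at h1
      rw [← h.1] at h2
      omega
  -- The edges from the vertices to their parents are distinct and number one less than the
  -- vertices, so they are all the edges of the tree.
  have hedges : (Finset.univ.erase r).image (fun u => s(u, f u)) = T.edgeFinset := by
    apply Finset.eq_of_subset_of_card_le
    · intro e he
      obtain ⟨u, hu, rfl⟩ := Finset.mem_image.1 he
      rw [SimpleGraph.mem_edgeFinset, SimpleGraph.mem_edgeSet]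
      exact (hf u (Finset.ne_of_mem_erase hu)).1
    · rw [Finset.card_image_of_injOn hinj, Finset.card_erase_of_mem (Finset.mem_univ _),
        Finset.card_univ, ← hT.card_edgeFinset]
      omega
  have hadj : ∀ u v, T.Adj u v ↔ (u ≠ r ∧ f u = v) ∨ (v ≠ r ∧ f v = u) := by
    intro u v
    constructor
    · intro h
      have : s(u, v) ∈ T.edgeFinset := by
        rwa [SimpleGraph.mem_edgeFinset, SimpleGraph.mem_edgeSet]
      rw [← hedges] at this
      obtain ⟨w, hw, hwe⟩ := Finset.mem_image.1 this
      have hwr := Finset.ne_of_mem_erase hw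
      rcases Sym2.eq_iff.1 hwe with ⟨rfl, h2⟩ | ⟨rfl, h2⟩
      · exact Or.inl ⟨hwr, h2⟩
      · exact Or.inr ⟨hwr, h2⟩
    · rintro (⟨h, rfl⟩ | ⟨h, rfl⟩)
      · exact (hf u h).1
      · exact (hf v h).1.symm
  refine ⟨f, mem_forestMaps.2 ⟨fun x hx => ?_, fun x _ => ⟨r, by simp, hdesc _ x rfl⟩⟩, hadj, ?_⟩
  · have hxr : x = r := by simpa using hx
    rw [hfr x hxr, hxr]
  · rintro u v ⟨huv, hlt⟩
    rcases (hadj u v).1 huv with h | ⟨hv, rfl⟩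
    · exact h
    · exact absurd (hf v hv).2 (not_lt.2 hlt.le)

/-- The tree with a given parent map. -/
def parentGraph (f : α → α) : SimpleGraph α := SimpleGraph.fromRel fun u v => f u = v

/-- Every vertex is connected to the root, and there is at most one edge for each other vertex. -/
theorem isTree_parentGraph (hf : IsForestMap (Finset.univ.erase r) {r} f) :
    (parentGraph f).IsTree := by
  classical
  have hconn : (parentGraph f).Connected := by
    have hr : ∀ x, (parentGraph f).Reachable x r := by
      intro x
      refine (reaches_root hf x).induction (P := fun z => (parentGraph f).Reachable z r)
        (SimpleGraph.Reachable.refl _) ?_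
      intro z _ _ ih
      by_cases hz : z = f z
      · rwa [← hz] at ih
      · refine SimpleGraph.Reachable.trans (SimpleGraph.Adj.reachable ?_) ih
        rw [parentGraph, SimpleGraph.fromRel_adj]
        exact ⟨hz, Or.inl rfl⟩
    have : Nonempty α := ⟨r⟩
    exact ⟨fun x y => (hr x).trans (hr y).symm⟩
  rw [SimpleGraph.isTree_iff_connected_and_card]
  refine ⟨hconn, le_antisymm ?_ hconn.card_vert_le_card_edgeSet_add_one⟩
  have hsub : (parentGraph f).edgeFinset ⊆ (Finset.univ.erase r).image fun u => s(u, f u) := by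
    intro e
    induction e using Sym2.ind with
    | _ u v =>
    rw [SimpleGraph.mem_edgeFinset, SimpleGraph.mem_edgeSet, parentGraph, SimpleGraph.fromRel_adj]
    have hne : ∀ x, x ≠ f x → x ∈ Finset.univ.erase r := by
      intro x hx
      by_contra h
      exact hx (hf.1 x h).symm
    rintro ⟨huv, rfl | rfl⟩
    · exact Finset.mem_image.2 ⟨u, hne u huv, rfl⟩
    · exact Finset.mem_image.2 ⟨v, hne v huv.symm, Sym2.eq_swap⟩
  have hcard := (Finset.card_le_card hsub).trans Finset.card_image_le
  rw [Finset.card_erase_of_mem (Finset.mem_univ _), Finset.card_univ] at hcard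
  rw [Nat.card_eq_fintype_card, Nat.card_eq_fintype_card, ← SimpleGraph.edgeFinset_card]
  have := Fintype.card_pos_iff.2 ⟨r⟩
  omega

/-- By induction from the root: if `f z` were not the parent of `z` for `g`, then `z` would be the
parent of `f z` for `g`, hence for `f` too, a cycle. -/
theorem parentGraph_injOn : Set.InjOn (parentGraph (α := α))
    (forestMaps (Finset.univ.erase r) {r} : Finset (α → α)) := by
  intro f hf g hg hfg
  rw [Finset.mem_coe, mem_forestMaps] at hf hg
  have hd : Disjoint (Finset.univ.erase r) ({r} : Finset α) := by simp
  funext x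
  refine hf.induction (P := fun x => f x = g x) ?_ ?_ (x := x) ?_
  · intro z hz
    rw [hf.fixed hd hz, hg.fixed hd hz]
  · intro z hz ih
    have hne : z ≠ f z := fun h => hf.not_reaches hd hz ⟨0, h.symm⟩
    have hadj : (parentGraph f).Adj z (f z) := by
      rw [parentGraph, SimpleGraph.fromRel_adj]
      exact ⟨hne, Or.inl rfl⟩
    rw [hfg, parentGraph, SimpleGraph.fromRel_adj] at hadj
    rcases hadj.2 with h | h
    · exact h.symm
    · exact absurd ⟨1, ih.trans h⟩ (hf.not_reaches hd hz)
  · by_cases hx : x = r <;> simp [hx]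

open Classical in
theorem card_forestMaps_le_card_trees (r : α) :
    (forestMaps (Finset.univ.erase r) {r}).card ≤
      (Finset.univ.filter fun T : SimpleGraph α => T.IsTree).card := by
  refine Finset.card_le_card_of_injOn parentGraph (fun f hf => ?_) parentGraph_injOn
  rw [Finset.mem_coe, mem_forestMaps] at hf
  simpa using isTree_parentGraph hf

open Classical in
/-- The mean over the trees is bounded by the mean over the parent maps. -/
theorem sum_trees_le (r : α) {φ : SimpleGraph α → ℝ} {ψ : (α → α) → ℝ} (hψ : ∀ f, 0 ≤ ψ f)
    (h : ∀ T : SimpleGraph α, T.IsTree → ∀ f ∈ forestMaps (Finset.univ.erase r) {r},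
      (∀ u v, (orientToRoot T r).Adj u v → u ≠ r ∧ f u = v) → φ T ≤ ψ f) :
    ∑ T with T.IsTree, φ T ≤ ∑ f ∈ forestMaps (Finset.univ.erase r) {r}, ψ f := by
  have hex : ∀ T : SimpleGraph α, ∃ f, T.IsTree → f ∈ forestMaps (Finset.univ.erase r) {r} ∧
      (∀ u v, T.Adj u v ↔ (u ≠ r ∧ f u = v) ∨ (v ≠ r ∧ f v = u)) ∧
      ∀ u v, (orientToRoot T r).Adj u v → u ≠ r ∧ f u = v := by
    intro T
    by_cases hT : T.IsTree
    · obtain ⟨f, hf⟩ := exists_parentMap hT r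
      exact ⟨f, fun _ => hf⟩
    · exact ⟨id, fun h => absurd h hT⟩
  choose p hp using hex
  have hinj : Set.InjOn p (Finset.univ.filter fun T : SimpleGraph α => T.IsTree) := by
    intro T hT T' hT' heq
    simp only [Finset.coe_filter, Finset.mem_univ, true_and, Set.mem_ofPred_eq] at hT hT'
    ext u v
    rw [(hp T hT).2.1, (hp T' hT').2.1, heq]
  calc ∑ T with T.IsTree, φ T ≤ ∑ T with T.IsTree, ψ (p T) := by
        refine Finset.sum_le_sum fun T hT => ?_
        have hT' := (Finset.mem_filter.1 hT).2
        exact h T hT' (p T) (hp T hT').1 (hp T hT').2.2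
    _ = ∑ f ∈ (Finset.univ.filter fun T : SimpleGraph α => T.IsTree).image p, ψ f :=
        (Finset.sum_image hinj).symm
    _ ≤ _ := by
        refine Finset.sum_le_sum_of_subset_of_nonneg ?_ fun f _ _ => hψ f
        intro f hf
        obtain ⟨T, hT, rfl⟩ := Finset.mem_image.1 hf
        exact (hp T (Finset.mem_filter.1 hT).2).1

end TreeParentMaps

/-! ### Union bounds over the random edges -/

section RandomEdges

open MeasureTheory ProbabilityTheory

/-- By independence the probability is a product, with a factor `p` for each element of `F` in `u`
and 0 for the others. -/
theorem setBernoulli_real_superset_le {ι : Type*} [Finite ι] (u : Set ι) (p : unitInterval)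
    (F : Finset ι) : (setBernoulli u p).real {E | ∀ e ∈ F, e ∈ E} ≤ (p : ℝ) ^ F.card := by
  have hpre : (fun q : ι → Prop => {i | q i}) ⁻¹' {E | ∀ e ∈ F, e ∈ E} =
      Set.pi F fun _ => {True} := by
    ext q
    simp [Set.mem_pi]
  rw [measureReal_def, setBernoulli_apply', hpre, Measure.infinitePi_pi _ (fun _ _ => by measurability)]
  rw [ENNReal.toReal_prod, ← Finset.prod_const]
  refine Finset.prod_le_prod (fun _ _ => ENNReal.toReal_nonneg) fun i _ => ?_
  by_cases hi : i ∈ u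
  · simp [hi]
  · simp [hi, p.2.1]

variable {m : ℕ} {f : Fin m → Fin m} {p : unitInterval}

instance isProbabilityMeasure_randomDigraphLaw (m : ℕ) (p : unitInterval) :
    IsProbabilityMeasure (randomDigraphLaw m p) := by
  unfold randomDigraphLaw
  infer_instance

/-- Union bound over the edges, with the indicator of a tall subtree bounded by a fourth power as in
Markov's inequality. Each origin has `m` possible ends. -/
theorem randomDigraphLaw_tall_le (f : Fin m → Fin m) (p : unitInterval) {B : ℝ} (hB : 0 < B) :
    (randomDigraphLaw m p).real {E | ∃ e ∈ E, B < (height f e.1 : ℝ) + 1} ≤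
      p * m / B ^ 4 * ∑ a, ((height f a : ℝ) + 1) ^ 4 := by
  have hsub : {E : Set (Fin m × Fin m) | ∃ e ∈ E, B < (height f e.1 : ℝ) + 1} ⊆
      ⋃ e : Fin m × Fin m, {E | e ∈ E ∧ B < (height f e.1 : ℝ) + 1} := by
    rintro E ⟨e, he, h⟩
    exact Set.mem_iUnion.2 ⟨e, he, h⟩
  calc _ ≤ (randomDigraphLaw m p).real _ := measureReal_mono hsub
    _ ≤ ∑ e : Fin m × Fin m, (randomDigraphLaw m p).real
          {E | e ∈ E ∧ B < (height f e.1 : ℝ) + 1} := measureReal_iUnion_fintype_le _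
    _ ≤ ∑ e : Fin m × Fin m, p * (((height f e.1 : ℝ) + 1) ^ 4 / B ^ 4) := by
        refine Finset.sum_le_sum fun e _ => ?_
        by_cases h : B < (height f e.1 : ℝ) + 1
        · have h1 : (randomDigraphLaw m p).real {E | e ∈ E ∧ B < (height f e.1 : ℝ) + 1} ≤ p := by
            have := setBernoulli_real_superset_le {e : Fin m × Fin m | e.1 ≠ e.2} p {e}
            simpa [h, randomDigraphLaw] using this
          refine h1.trans (le_mul_of_one_le_right p.2.1 ?_)
          rw [one_le_div (by positivity)]
          gcongr
        · have hp := p.2.1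
          simp only [h, and_false, Set.ofPred_false, measureReal_empty]
          positivity
    _ = _ := by
        rw [Fintype.sum_prod_type]
        simp only [Finset.sum_const, Finset.card_univ, Fintype.card_fin, nsmul_eq_mul]
        rw [Finset.mul_sum]
        refine Finset.sum_congr rfl fun a _ => ?_
        ring

/-- Union bound: from `a` there are `m ^ 5` choices of ends and `(2 * (height f a + 1)) ^ 4` of
segment lengths, and five distinct edges are present with probability at most `p ^ 5`. -/
theorem randomDigraphLaw_hasShortJumps_le (f : Fin m → Fin m) (p : unitInterval) :
    (randomDigraphLaw m p).real {E | HasShortJumps f E} ≤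
      16 * (p : ℝ) ^ 5 * m ^ 5 * ∑ a, ((height f a : ℝ) + 1) ^ 4 := by
  have hp := p.2.1
  have hsub : {E : Set (Fin m × Fin m) | HasShortJumps f E} ⊆
      ⋃ s : (a : Fin m) × (Fin 5 → Fin m) × (Fin 4 → Fin (2 * (height f a + 1))),
        {E | Function.Injective (jumpChain f s.1 s.2.1 fun i => s.2.2 i) ∧
          ∀ j, jumpChain f s.1 s.2.1 (fun i => s.2.2 i) j ∈ E} := by
    rintro E ⟨a, b, l, h⟩
    exact Set.mem_iUnion.2 ⟨⟨a, b, l⟩, h⟩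
  calc _ ≤ (randomDigraphLaw m p).real _ := measureReal_mono hsub
    _ ≤ ∑ s : (a : Fin m) × (Fin 5 → Fin m) × (Fin 4 → Fin (2 * (height f a + 1))),
          (randomDigraphLaw m p).real
            {E | Function.Injective (jumpChain f s.1 s.2.1 fun i => s.2.2 i) ∧
              ∀ j, jumpChain f s.1 s.2.1 (fun i => s.2.2 i) j ∈ E} :=
        measureReal_iUnion_fintype_le _
    _ ≤ ∑ s : (a : Fin m) × (Fin 5 → Fin m) × (Fin 4 → Fin (2 * (height f a + 1))),
          (p : ℝ) ^ 5 := by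
        refine Finset.sum_le_sum fun s _ => ?_
        by_cases h : Function.Injective (jumpChain f s.1 s.2.1 fun i => s.2.2 i)
        · have := setBernoulli_real_superset_le {e : Fin m × Fin m | e.1 ≠ e.2} p
            (Finset.univ.image (jumpChain f s.1 s.2.1 fun i => s.2.2 i))
          rw [Finset.card_image_of_injective _ h] at this
          simpa [h, randomDigraphLaw] using this
        · simp only [h, false_and, Set.ofPred_false, measureReal_empty]
          positivity
    _ = _ := by
        rw [Fintype.sum_sigma]
        simp only [Finset.sum_const, Finset.card_univ, Fintype.card_prod, Fintype.card_fun,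
          Fintype.card_fin, nsmul_eq_mul]
        rw [Finset.mul_sum]
        refine Finset.sum_congr rfl fun a _ => ?_
        push_cast
        ring

/-- For a given tree, the saops of the union with the random digraph are long with a small
probability, unless the tree is high. -/
theorem randomDigraphLaw_longestSaop_le [NeZero m] {T : SimpleGraph (Fin m)}
    (hf : IsForestMap (Finset.univ.erase 0) {0} f)
    (hT : ∀ u v, (orientToRoot T 0).Adj u v → u ≠ 0 ∧ f u = v) {x : ℝ} (hx : 32 ≤ x) :
    (randomDigraphLaw m p).real
        {E | x * √(m : ℝ) < (longestSaop (treeUnionDigraph (T, E)) : ℝ)} ≤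
      16 * (height f 0 : ℝ) ^ 4 / (x ^ 4 * m ^ 2) +
        ((p : ℝ) / m + 16 * (p : ℝ) ^ 5 * m ^ 5) * ∑ a, ((height f a : ℝ) + 1) ^ 4 := by
  have hp := p.2.1
  have hm : (0 : ℝ) < m := by exact_mod_cast NeZero.pos m
  have hs : 0 < √(m : ℝ) := Real.sqrt_pos.2 hm
  have hss : √(m : ℝ) ^ 4 = m ^ 2 := by
    rw [show √(m : ℝ) ^ 4 = (√(m : ℝ) ^ 2) ^ 2 by ring, Real.sq_sqrt hm.le]
  have hx0 : 0 < x := by linarith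
  have hsum : 0 ≤ ((p : ℝ) / m + 16 * (p : ℝ) ^ 5 * m ^ 5) * ∑ a, ((height f a : ℝ) + 1) ^ 4 := by
    positivity
  -- If the tree is higher than `x √m / 2`, the first term is at least 1. If not, `longestSaop_le`
  -- with `B = √m` leaves room, since `16 ≤ x / 2`.
  rcases lt_or_ge (x / 2 * √(m : ℝ)) (height f 0) with hH | hH
  · have h1 : 1 ≤ 16 * (height f 0 : ℝ) ^ 4 / (x ^ 4 * m ^ 2) := by
      rw [one_le_div (by positivity)]
      have : (x / 2 * √(m : ℝ)) ^ 4 ≤ (height f 0 : ℝ) ^ 4 := by gcongr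
      rw [mul_pow, hss] at this
      linarith
    exact measureReal_le_one.trans (by linarith)
  · have hsub : {E | x * √(m : ℝ) < (longestSaop (treeUnionDigraph (T, E)) : ℝ)} ⊆
        {E | ∃ e ∈ E, √(m : ℝ) < (height f e.1 : ℝ) + 1} ∪ {E | HasShortJumps f E} := by
      intro E hE
      by_contra hcon
      simp only [Set.mem_union, Set.mem_ofPred_eq, not_or, not_exists, not_and, not_lt] at hcon hE
      have hG : ∀ u v, (treeUnionDigraph (T, E)).Adj u v → (u ≠ 0 ∧ f u = v) ∨ (u, v) ∈ E := by
        rintro u v (h | h)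
        · exact Or.inl (hT u v h)
        · exact Or.inr h
      have := longestSaop_le (reaches_root hf) hG hs.le hcon.1 hcon.2
      nlinarith
    have h1 := randomDigraphLaw_tall_le f p hs
    have h2 := randomDigraphLaw_hasShortJumps_le f p
    rw [hss] at h1
    calc _ ≤ _ := measureReal_mono hsub
      _ ≤ _ := measureReal_union_le _ _
      _ ≤ _ := add_le_add h1 h2
      _ = ((p : ℝ) / m + 16 * (p : ℝ) ^ 5 * m ^ 5) * ∑ a, ((height f a : ℝ) + 1) ^ 4 := by
        field_simp
      _ ≤ _ := le_add_of_nonneg_left (by positivity)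

end RandomEdges

/-! ### Averaging over the tree and conclusion -/

section Main

open MeasureTheory ProbabilityTheory

open Classical in
theorem uniformTreeLaw_real_singleton {m : ℕ} (T : SimpleGraph (Fin m)) :
    (uniformTreeLaw m).real {T} = if T.IsTree then
      ((Finset.univ.filter fun T : SimpleGraph (Fin m) => T.IsTree).card : ℝ)⁻¹ else 0 := by
  have h := uniformOn_apply_finset
    (s := Finset.univ.filter fun T : SimpleGraph (Fin m) => T.IsTree) (t := {T})
  simp only [Finset.coe_filter, Finset.mem_univ, true_and, Finset.coe_singleton] at h
  rw [measureReal_def, uniformTreeLaw, h]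
  split_ifs with hT
  · rw [Finset.inter_singleton_of_mem (by simpa using hT)]
    simp
  · rw [Finset.inter_singleton_of_notMem (by simpa using hT)]
    simp

open Classical in
theorem treeAndDigraphLaw_real_le {m : ℕ} [NeZero m] (p : unitInterval)
    (S : Set (SimpleGraph (Fin m) × Set (Fin m × Fin m))) :
    (treeAndDigraphLaw m p).real S ≤
      ((Finset.univ.filter fun T : SimpleGraph (Fin m) => T.IsTree).card : ℝ)⁻¹ *
        ∑ T : SimpleGraph (Fin m) with T.IsTree, (randomDigraphLaw m p).real {E | (T, E) ∈ S} := by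
  have := isProbabilityMeasure_uniformTreeLaw m
  have := isProbabilityMeasure_treeAndDigraphLaw m p
  have hsub : S ⊆ ⋃ T : SimpleGraph (Fin m), {T} ×ˢ {E | (T, E) ∈ S} := by
    rintro ⟨T, E⟩ h
    exact Set.mem_iUnion.2 ⟨T, rfl, h⟩
  calc _ ≤ (treeAndDigraphLaw m p).real _ := measureReal_mono hsub
    _ ≤ ∑ T : SimpleGraph (Fin m), (treeAndDigraphLaw m p).real ({T} ×ˢ {E | (T, E) ∈ S}) :=
        measureReal_iUnion_fintype_le _
    _ = ∑ T : SimpleGraph (Fin m),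
          (uniformTreeLaw m).real {T} * (randomDigraphLaw m p).real {E | (T, E) ∈ S} := by
        refine Finset.sum_congr rfl fun T _ => ?_
        rw [treeAndDigraphLaw, measureReal_prod_prod]
    _ = _ := by
        rw [Finset.mul_sum, Finset.sum_filter]
        refine Finset.sum_congr rfl fun T _ => ?_
        rw [uniformTreeLaw_real_singleton]
        split_ifs <;> simp

theorem mean_bound {N A C D x m p s S₁ S₂ : ℝ} (hN : 0 < N) (hAN : A ≤ N) (hp : 0 ≤ p)
    (hm : 0 < m) (hx : 0 < x) (hs : 0 ≤ s) (hC : 0 ≤ C) (hD : 0 ≤ D)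
    (h₁ : S₁ ≤ C * m ^ 2 * A) (h₂ : S₂ ≤ D * (m ^ 2 * s) * A) :
    N⁻¹ * (16 * S₁ / (x ^ 4 * m ^ 2) + (p / m + 16 * p ^ 5 * m ^ 5) * S₂) ≤
      16 * C / x ^ 4 + D * (p * (m * s) + 16 * (p ^ 5 * (m ^ 7 * s))) := by
  have hN1 : N⁻¹ * A ≤ 1 := by
    rwa [inv_mul_le_iff₀ hN, mul_one]
  calc _ ≤ N⁻¹ * (16 * (C * m ^ 2 * A) / (x ^ 4 * m ^ 2) +
          (p / m + 16 * p ^ 5 * m ^ 5) * (D * (m ^ 2 * s) * A)) := by gcongr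
    _ = (N⁻¹ * A) * (16 * C / x ^ 4 + D * (p * (m * s) + 16 * (p ^ 5 * (m ^ 7 * s)))) := by
        field_simp
    _ ≤ 1 * (16 * C / x ^ 4 + D * (p * (m * s) + 16 * (p ^ 5 * (m ^ 7 * s)))) := by gcongr
    _ = _ := one_mul _

theorem treeAndDigraphLaw_longestSaop_le (m : ℕ) [NeZero m] (p : unitInterval) {x : ℝ}
    (hx : 32 ≤ x) :
    (treeAndDigraphLaw m p).real {ω | x * √(m : ℝ) < (longestSaop (treeUnionDigraph ω) : ℝ)} ≤
      16 * 22781250 / x ^ 4 +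
        8 * 22781251 ^ 2 * (p * (m * √(m : ℝ)) + 16 * ((p : ℝ) ^ 5 * (m ^ 7 * √(m : ℝ)))) := by
  classical
  have hp := p.2.1
  have hm : (0 : ℝ) < m := by exact_mod_cast NeZero.pos m
  have hx0 : 0 < x := by linarith
  obtain ⟨ψ, hψ⟩ : ∃ ψ : (Fin m → Fin m) → ℝ, ∀ f, ψ f =
      16 * (height f 0 : ℝ) ^ 4 / (x ^ 4 * m ^ 2) +
        ((p : ℝ) / m + 16 * (p : ℝ) ^ 5 * m ^ 5) * ∑ a, ((height f a : ℝ) + 1) ^ 4 :=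
    ⟨_, fun _ => rfl⟩
  have hψ0 : ∀ f, 0 ≤ ψ f := fun f => by
    rw [hψ]
    positivity
  set W : Finset (Fin m) := Finset.univ.erase 0 with hW
  have h0 : (0 : Fin m) ∉ W := Finset.notMem_erase _ _
  have hins : insert 0 W = Finset.univ := Finset.insert_erase (Finset.mem_univ _)
  have hcard : (W.card : ℝ) + 1 = m := by
    have := Finset.card_insert_of_notMem h0
    rw [hins, Finset.card_univ, Fintype.card_fin] at this
    exact_mod_cast this.symm
  set N : ℝ := ((Finset.univ.filter fun T : SimpleGraph (Fin m) => T.IsTree).card : ℝ) with hN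
  set A : ℝ := ((forestMaps W {0}).card : ℝ) with hA
  have hAN : A ≤ N := by
    rw [hA, hN]
    exact Nat.cast_le.2 (card_forestMaps_le_card_trees (0 : Fin m))
  have hN0 : 0 < N := by
    obtain ⟨T, -, hT⟩ := (SimpleGraph.connected_top (V := Fin m)).exists_isTree_le
    rw [hN]
    exact Nat.cast_pos.2 (Finset.card_pos.2 ⟨T, by simpa using hT⟩)
  obtain ⟨C, hC⟩ : ∃ C : ℝ, C = 22781250 := ⟨_, rfl⟩
  obtain ⟨D, hD⟩ : ∃ D : ℝ, D = 8 * 22781251 ^ 2 := ⟨_, rfl⟩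
  have hC0 : 0 ≤ C := by rw [hC]; norm_num
  have hD0 : 0 ≤ D := by rw [hD]; norm_num
  have h1 := sum_trees_le (0 : Fin m) hψ0
    (φ := fun T => (randomDigraphLaw m p).real
      {E | x * √(m : ℝ) < (longestSaop (treeUnionDigraph (T, E)) : ℝ)})
    fun T _ f hf hT => by
      rw [hψ]
      exact randomDigraphLaw_longestSaop_le (mem_forestMaps.1 hf) hT hx
  have h2 := sum_height_pow_le W 0 h0
  have h3 := sum_sum_height_pow_le h0
  rw [hins, hcard] at h3
  rw [hcard] at h2
  rw [← hD] at h3 ⊢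
  rw [← hC] at h2 ⊢
  refine (treeAndDigraphLaw_real_le p _).trans ?_
  calc _ ≤ N⁻¹ * ∑ f ∈ forestMaps W {0}, ψ f :=
        mul_le_mul_of_nonneg_left h1 (inv_nonneg.2 hN0.le)
    _ = N⁻¹ * (16 * (∑ f ∈ forestMaps W {0}, (height f 0 : ℝ) ^ 4) / (x ^ 4 * m ^ 2) +
          ((p : ℝ) / m + 16 * (p : ℝ) ^ 5 * m ^ 5) *
            ∑ f ∈ forestMaps W {0}, ∑ a, ((height f a : ℝ) + 1) ^ 4) := by
        simp only [hψ, Finset.sum_add_distrib, Finset.mul_sum, Finset.sum_div]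
    _ ≤ _ := mean_bound hN0 hAN hp hm hx0 (Real.sqrt_nonneg _) hC0 hD0 h2 h3

end Main

theorem proposition2p2 :
    ∃ C : ℝ, 0 < C ∧ ∀ (m : ℕ) [NeZero m] (p : unitInterval) (x : ℝ),
      0 < (p : ℝ) → 0 < x →
        (treeAndDigraphLaw m p).real
            {ω | x * √(m : ℝ) < (longestSaop (treeUnionDigraph ω) : ℝ)} ≤
          C * (1 / x ^ 2 + (p : ℝ) ^ (2 / 3 : ℝ) * (m : ℝ)) := by
  refine ⟨17 * (8 * 22781251 ^ 2), by norm_num, fun m _ p x hp hx => ?_⟩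
  have := isProbabilityMeasure_treeAndDigraphLaw m p
  have hm : (0 : ℝ) < m := by exact_mod_cast NeZero.pos m
  -- With `c = p^(1/3)` and `s = √m`, the target is `(c * s) ^ 2` and the two error terms are `(c *
  -- s) ^ 3` and `(c * s) ^ 15`.
  set c : ℝ := (p : ℝ) ^ (1 / 3 : ℝ) with hc
  have hc0 : 0 < c := Real.rpow_pos_of_pos hp _
  have hc2 : (p : ℝ) ^ (2 / 3 : ℝ) = c ^ 2 := by
    rw [hc, ← Real.rpow_natCast, ← Real.rpow_mul hp.le]
    norm_num
  have hc3 : (p : ℝ) = c ^ 3 := by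
    rw [hc, ← Real.rpow_natCast, ← Real.rpow_mul hp.le]
    norm_num
  set s := √(m : ℝ) with hs
  have hs0 : 0 < s := Real.sqrt_pos.2 hm
  have hms : (m : ℝ) = s ^ 2 := (Real.sq_sqrt hm.le).symm
  have hu : (p : ℝ) ^ (2 / 3 : ℝ) * m = (c * s) ^ 2 := by rw [hc2, hms]; ring
  rw [hu]
  have hu0 : 0 < c * s := mul_pos hc0 hs0
  have hx2 : 0 < 1 / x ^ 2 := by positivity
  -- For `x < 32` or `c * s > 1` the right-hand side already exceeds 1.
  rcases lt_or_ge x 32 with hx32 | hx32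
  · refine MeasureTheory.measureReal_le_one.trans ?_
    have : 1 / 1024 ≤ 1 / x ^ 2 := one_div_le_one_div_of_le (by positivity) (by nlinarith)
    nlinarith [sq_nonneg (c * s)]
  rcases lt_or_ge 1 (c * s) with hcs | hcs
  · refine MeasureTheory.measureReal_le_one.trans ?_
    nlinarith
  · refine (treeAndDigraphLaw_longestSaop_le m p hx32).trans ?_
    rw [← hs]
    have e1 : (p : ℝ) * (m * s) = (c * s) ^ 3 := by rw [hc3, hms]; ring
    have e2 : (p : ℝ) ^ 5 * (m ^ 7 * s) = (c * s) ^ 15 := by rw [hc3, hms]; ring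
    have h1 : (c * s) ^ 3 ≤ (c * s) ^ 2 := pow_le_pow_of_le_one hu0.le hcs (by norm_num)
    have h2 : (c * s) ^ 15 ≤ (c * s) ^ 2 := pow_le_pow_of_le_one hu0.le hcs (by norm_num)
    have h3 : 1 / x ^ 4 ≤ 1 / x ^ 2 :=
      one_div_le_one_div_of_le (by positivity) (pow_le_pow_right₀ (by linarith) (by norm_num))
    rw [e1, e2, mul_div_assoc, div_eq_mul_one_div _ (x ^ 4)]
    nlinarith
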